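/- Fix $0<\mu\le\frac12$, $0<q_1\le1$, $A_2\ge0$, $c_d>0$; put $n=\sqrt{1+\frac32A_2}$, $W_1=(1-\mu)(1-q_1)/c_d$, $r_1^2=(x+\mu)^2+y^2$, $r_2^2=(x+\mu-1)^2+y^2$, and consider the Lagrangian $$L=\tfrac12(\dot x^2+\dot y^2)+n(x\dot y-\dot xy)+\tfrac{n^2}{2}(x^2+y^2)+\frac{(1-\mu)q_1}{r_1}+\frac{\mu}{r_2}+\frac{\mu A_2}{2r_2^3}+W_1\Big\{\frac{(x+\mu)\dot x+y\dot y}{2r_1^2}-n\arctan\frac{y}{x+\mu}\Big\}$$ with $p_x=\partial L/\partial\dot x$, $p_y=\partial L/\partial\dot y$ and Hamiltonian $H=-L+p_x\dot x+p_y\dot y$. Let $(x_*,y_*)$ be a triangular equilibrium, i.e. a rest point of $$\ddot x-2n\dot y=\frac{\partial U_1}{\partial x}-\frac{W_1N_1}{r_1^2},\qquad \ddot y+2n\dot x=\frac{\partial U_1}{\partial y}-\frac{W_1N_2}{r_1^2},$$ with $U_1=\frac{n^2(x^2+y^2)}2+\frac{(1-\mu)q_1}{r_1}+\frac\mu{r_2}+\frac{\mu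 A_2}{2r_2^3}$, $N_1=\frac{(x+\mu)[(x+\mu)\dot x+y\dot y]}{r_1^2}+\dot x-ny$, $N_2=\frac{y[(x+\mu)\dot x+y\dot y]}{r_1^2}+\dot y+n(x+\mu)$, and assume $y_*\ne0$, $x_*+\mu\neq0$. Shift the origin to $(x_*,y_*)$ and let $L_k$ be the homogeneous part of degree $k$ of the Taylor expansion of $L$ in $(x,y,\dot x,\dot y)$. Define $E,F,G$ by $L_2(x,y,0,0)=\frac{n^2}{2}(x^2+y^2)-Ex^2-Fy^2-Gxy$ and $H_2=\frac12(p_x^2+p_y^2)+n(yp_x-xp_y)+Ex^2+Fy^2+Gxy$. Assume that the characteristic equation $\lambda^4+2(E+F+n^2)\lambda^2+4EF-G^2+n^4-2n^2(E+F)=0$ has roots $\pm i\omega_1,\pm i\omega_2$ with $0<\omega_2<\omega_1$, and that $k_1\omega_1+k_2\omega_2\ne0$ for all integers $(k_1,k_2)\neq(0,0)$ with $|k_1|+|k_2|\le4$. A homogeneous double D'Alembert component of degree $k$ is a function $$\sum_{0\le m\le k}I_1^{\frac{k-m}2}I_2^{\frac m2}\sum_{p,q}\big[C_{k-m,m,p,q}\cos(p\phi_1+q\phi_2)+S_{k-m,m,p,q}\sin(p\phi_1+q\phi_2)\big]\qquad(I_1,I_2\ge0),$$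 where $0\le p\le k-m$ has the parity of $k-m$ and $-m\le q\le m$ has the parity of $m$. Let $D=\omega_1\partial_{\phi_1}-\omega_2\partial_{\phi_2}$. Put $l_j=2\sqrt{\omega_j^2+n^2-2F}$ and $\kappa=\sqrt{\omega_1^2-\omega_2^2}$, let $P_i=\sqrt{2I_i\omega_i}\cos\phi_i$, $Q_i=\sqrt{2I_i/\omega_i}\sin\phi_i$, and let $(x,y,p_x,p_y)^T=J(Q_1,Q_2,P_1,P_2)^T$ be given by $x=J_{13}P_1+J_{14}P_2$, $y=J_{21}Q_1+J_{22}Q_2+J_{23}P_1+J_{24}P_2$, $p_x=Dx-ny$, $p_y=Dy+nx$, with $$J_{13}=\frac{l_1}{2\omega_1\kappa},\quad J_{14}=\frac{l_2}{2\omega_2\kappa},\quad J_{21}=-\frac{4n\omega_1}{l_1\kappa},\quad J_{22}=\frac{4n\omega_2}{l_2\kappa},\quad J_{23}=\frac{2G}{\omega_1l_1\kappa},\quad J_{24}=\frac{2G}{\omega_2l_2\kappa}.$$ Then: (1) $J$ is symplectic and turns $H_2$ into $\omega_1I_1-\omega_2I_2$. Accordingly let the first-order components $B_1^{1,0}$,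 $B_1^{0,1}$ be the above $x$, $y$; they are homogeneous D'Alembert components of degree $1$. (2) Let $X_2=\frac{\partial L_3}{\partial x}-D\frac{\partial L_3}{\partial\dot x}$ and $Y_2=\frac{\partial L_3}{\partial y}-D\frac{\partial L_3}{\partial\dot y}$, evaluated at $x=B_1^{1,0}$, $y=B_1^{0,1}$, $\dot x=DB_1^{1,0}$, $\dot y=DB_1^{0,1}$. The equations $$(D^2+2E-n^2)B_2^{1,0}-(2nD-G)B_2^{0,1}=X_2,\qquad(2nD+G)B_2^{1,0}+(D^2+2F-n^2)B_2^{0,1}=Y_2$$ have exactly one solution $(B_2^{1,0},B_2^{0,1})$ in homogeneous D'Alembert components of degree $2$. The divisors $\triangle_{p,q}=[\omega_1^2-(\omega_1p-\omega_2q)^2][\omega_2^2-(\omega_1p-\omega_2q)^2]$ for the indices $(p,q)$ of degree $2$ are nonzero; $\Phi_2=(D^2+2F-n^2)X_2+(2nD-G)Y_2$ and $\Psi_2=(2nD+G)X_2-(D^2+2E-n^2)Y_2$ are homogeneous D'Alembert components of degree $2$; and $B_2^{1,0}$, $B_2^{0,1}$ are obtained from $\Phi_2$, $-\Psi_2$ by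 dividing the coefficients of $\cos(p\phi_1+q\phi_2)$, $\sin(p\phi_1+q\phi_2)$ by $\triangle_{p,q}$. (3) After the substitution $x=B_1^{1,0}+B_2^{1,0}$, $y=B_1^{0,1}+B_2^{0,1}$ (with $\dot x=Dx$, $\dot y=Dy$) the part of $H$ of order $3$ in $I_1^{1/2},I_2^{1/2}$, written as $$H_3=A_{3,0}I_1^{3/2}+A_{2,1}I_1I_2^{1/2}+A_{1,2}I_1^{1/2}I_2+A_{0,3}I_2^{3/2}$$ with coefficients $A_{i,j}$ depending on $(\phi_1,\phi_2)$, has $A_{3,0}=A_{2,1}=A_{1,2}=A_{0,3}=0$ identically. -/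

import Mathlib

/-- The data of the planar generalized photogravitational restricted three body problem:
mass parameter `μ`, mass reduction factor `q₁` of the radiating primary, oblateness coefficient
`A₂` of the smaller primary, dimensionless velocity of light `cd`, together with
a point `(xs, ys)` of the rotating plane and two positive numbers `ω₁, ω₂`
(the theorem asks that `(xs, ys)` is a triangular equilibrium, and that `ω₁, ω₂` are the basic
frequencies there). -/
structure PRModel where
  μ : ℝ
  q₁ : ℝ
  A₂ : ℝ
  cd : ℝ
  xs : ℝ
  ys : ℝ
  ω₁ : ℝ
  ω₂ : ℝ

/-- Real functions of the actions `I₁, I₂` and the angles `φ₁, φ₂`, in this order. -/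
abbrev ActionAngleFun : Type := ℝ → ℝ → ℝ → ℝ → ℝ

/-- The indices `p` in `0 ≤ p ≤ k` of the same parity as `k`. -/
def dAlembertP (k : ℕ) : Finset ℕ := (Finset.range (k + 1)).filter (fun p => p % 2 = k % 2)

/-- The indices `q` in `-m ≤ q ≤ m` of the same parity as `m`. -/
noncomputable def dAlembertQ (m : ℕ) : Finset ℤ :=
  (Finset.Icc (-(m : ℤ)) (m : ℤ)).filter (fun q => q % 2 = (m : ℤ) % 2)

/-- The homogeneous double D'Alembert component of degree `k` (in `I₁^{1/2}, I₂^{1/2}`) with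
coefficients `C_{k-m,m,p,q} = C m p q` and `S_{k-m,m,p,q} = S m p q`. -/
noncomputable def dAlembertComp (k : ℕ) (C S : ℕ → ℕ → ℤ → ℝ) : ActionAngleFun :=
  fun I₁ I₂ φ₁ φ₂ =>
    ∑ m ∈ Finset.range (k + 1), √I₁ ^ (k - m) * √I₂ ^ m *
      ∑ p ∈ dAlembertP (k - m), ∑ q ∈ dAlembertQ m,
        (C m p q * Real.cos (p * φ₁ + q * φ₂) + S m p q * Real.sin (p * φ₁ + q * φ₂))

/-- Equality of two functions of action-angle variables, for all actions `I₁, I₂ ≥ 0`. -/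
def ActionAngleFun.Agree (f g : ActionAngleFun) : Prop :=
  ∀ I₁ I₂ φ₁ φ₂ : ℝ, 0 ≤ I₁ → 0 ≤ I₂ → f I₁ I₂ φ₁ φ₂ = g I₁ I₂ φ₁ φ₂

/-- `f` is a homogeneous double D'Alembert component of degree `k`. -/
def IsDAlembertComp (k : ℕ) (f : ActionAngleFun) : Prop :=
  ∃ C S : ℕ → ℕ → ℤ → ℝ, ActionAngleFun.Agree f (dAlembertComp k C S)

namespace PRModel

/-- The mean motion, `n² = 1 + (3/2) A₂`. -/
noncomputable def n (M : PRModel) : ℝ := √(1 + 3 / 2 * M.A₂)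

/-- The Poynting-Robertson drag coefficient `W₁ = (1 - μ)(1 - q₁) / c_d`. -/
noncomputable def W₁ (M : PRModel) : ℝ := (1 - M.μ) * (1 - M.q₁) / M.cd

/-- Distance to the radiating primary. -/
noncomputable def r₁ (M : PRModel) (x y : ℝ) : ℝ := √((x + M.μ) ^ 2 + y ^ 2)

/-- Distance to the oblate primary. -/
noncomputable def r₂ (M : PRModel) (x y : ℝ) : ℝ := √((x + M.μ - 1) ^ 2 + y ^ 2)

noncomputable def U₁ (M : PRModel) (x y : ℝ) : ℝ :=
  M.n ^ 2 * (x ^ 2 + y ^ 2) / 2 + (1 - M.μ) * M.q₁ / M.r₁ x y + M.μ / M.r₂ x y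
    + M.μ * M.A₂ / (2 * M.r₂ x y ^ 3)

/-- The drag factors `N₁, N₂` at position `(x, y)` and velocity `(u, v)`. -/
noncomputable def N₁ (M : PRModel) (x y u v : ℝ) : ℝ :=
  (x + M.μ) * ((x + M.μ) * u + y * v) / M.r₁ x y ^ 2 + u - M.n * y

noncomputable def N₂ (M : PRModel) (x y u v : ℝ) : ℝ :=
  y * ((x + M.μ) * u + y * v) / M.r₁ x y ^ 2 + v + M.n * (x + M.μ)

/-- The right-hand sides `U_x, U_y` of the equations of motion
`ẍ - 2nẏ = U_x`, `ÿ + 2nẋ = U_y`. -/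
noncomputable def Ux (M : PRModel) (x y u v : ℝ) : ℝ :=
  deriv (fun t => M.U₁ t y) x - M.W₁ * M.N₁ x y u v / M.r₁ x y ^ 2

noncomputable def Uy (M : PRModel) (x y u v : ℝ) : ℝ :=
  deriv (fun t => M.U₁ x t) y - M.W₁ * M.N₂ x y u v / M.r₁ x y ^ 2

/-- `(xs, ys)` is a triangular equilibrium point: `U_x = U_y = 0` at rest, and `ys ≠ 0`. -/
def IsTriangularEquilibrium (M : PRModel) : Prop :=
  M.Ux M.xs M.ys 0 0 = 0 ∧ M.Uy M.xs M.ys 0 0 = 0 ∧ M.ys ≠ 0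

/-- The Lagrangian at position `(x, y)` and velocity `(u, v)`. -/
noncomputable def L (M : PRModel) (x y u v : ℝ) : ℝ :=
  (u ^ 2 + v ^ 2) / 2 + M.n * (x * v - u * y) + M.n ^ 2 / 2 * (x ^ 2 + y ^ 2)
    + (1 - M.μ) * M.q₁ / M.r₁ x y + M.μ / M.r₂ x y + M.μ * M.A₂ / (2 * M.r₂ x y ^ 3)
    + M.W₁ * (((x + M.μ) * u + y * v) / (2 * M.r₁ x y ^ 2)
        - M.n * Real.arctan (y / (x + M.μ)))

/-- The momenta `p_x = ∂L/∂ẋ`, `p_y = ∂L/∂ẏ`. -/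
noncomputable def px (M : PRModel) (x y u v : ℝ) : ℝ := deriv (fun t => M.L x y t v) u

noncomputable def py (M : PRModel) (x y u v : ℝ) : ℝ := deriv (fun t => M.L x y u t) v

/-- The Hamiltonian `H = -L + p_x ẋ + p_y ẏ`, as a function of position and velocity. -/
noncomputable def H (M : PRModel) (x y u v : ℝ) : ℝ :=
  -M.L x y u v + M.px x y u v * u + M.py x y u v * v

/-- `L_k`: the homogeneous part of degree `k` of the power series expansion of the Lagrangian at
the equilibrium, in the shifted coordinates `(x, y)` and the velocities `(u, v)`. -/
noncomputable def Lpart (M : PRModel) (k : ℕ) (x y u v : ℝ) : ℝ :=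
  iteratedDeriv k (fun s : ℝ => M.L (M.xs + s * x) (M.ys + s * y) (s * u) (s * v)) 0
    / (k.factorial : ℝ)

/-- The coefficients `E, F, G` are determined by
`L₂(x, y, 0, 0) = (n²/2)(x² + y²) - E x² - F y² - G x y`. -/
noncomputable def E (M : PRModel) : ℝ := M.n ^ 2 / 2 - M.Lpart 2 1 0 0 0

noncomputable def F (M : PRModel) : ℝ := M.n ^ 2 / 2 - M.Lpart 2 0 1 0 0

noncomputable def G (M : PRModel) : ℝ := M.n ^ 2 - M.E - M.F - M.Lpart 2 1 1 0 0

/-- The quadratic Hamiltonian `H₂` at the phase point `X = (x, y, p_x, p_y)`. -/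
noncomputable def H₂ (M : PRModel) (X : Fin 2 ⊕ Fin 2 → ℝ) : ℝ :=
  (X (.inr 0) ^ 2 + X (.inr 1) ^ 2) / 2
    + M.n * (X (.inl 1) * X (.inr 0) - X (.inl 0) * X (.inr 1))
    + M.E * X (.inl 0) ^ 2 + M.F * X (.inl 1) ^ 2 + M.G * (X (.inl 0) * X (.inl 1))

/-- The left-hand side of the characteristic equation of `H₂`. -/
noncomputable def charEq (M : PRModel) (z : ℂ) : ℂ :=
  z ^ 4 + 2 * (M.E + M.F + M.n ^ 2) * z ^ 2
    + (4 * M.E * M.F - M.G ^ 2 + M.n ^ 4 - 2 * M.n ^ 2 * (M.E + M.F))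

/-- `±iω₁, ±iω₂` are the characteristic roots, with `0 < ω₂ < ω₁`. -/
def HasFrequencies (M : PRModel) : Prop :=
  0 < M.ω₂ ∧ M.ω₂ < M.ω₁ ∧ M.charEq (Complex.I * M.ω₁) = 0 ∧ M.charEq (Complex.I * M.ω₂) = 0

/-- No resonance up to order 4. -/
def NonResonant (M : PRModel) : Prop :=
  ∀ k₁ k₂ : ℤ, (k₁, k₂) ≠ (0, 0) → |k₁| + |k₂| ≤ 4 → (k₁ : ℝ) * M.ω₁ + k₂ * M.ω₂ ≠ 0

/-- `l_j² = 4 (ω_j² + n² - 2F)`, which is `4 ω_j² + 9` for the classical problem. -/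
noncomputable def l₁ (M : PRModel) : ℝ := √(4 * (M.ω₁ ^ 2 + M.n ^ 2 - 2 * M.F))

noncomputable def l₂ (M : PRModel) : ℝ := √(4 * (M.ω₂ ^ 2 + M.n ^ 2 - 2 * M.F))

/-- `k² = ω₁² - ω₂²`, which is `2 ω₁² - 1 = 1 - 2 ω₂²` for the classical problem. -/
noncomputable def k (M : PRModel) : ℝ := √(M.ω₁ ^ 2 - M.ω₂ ^ 2)

noncomputable def J₁₃ (M : PRModel) : ℝ := M.l₁ / (2 * M.ω₁ * M.k)

noncomputable def J₁₄ (M : PRModel) : ℝ := M.l₂ / (2 * M.ω₂ * M.k)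

noncomputable def J₂₁ (M : PRModel) : ℝ := -(4 * M.n * M.ω₁) / (M.l₁ * M.k)

noncomputable def J₂₂ (M : PRModel) : ℝ := 4 * M.n * M.ω₂ / (M.l₂ * M.k)

noncomputable def J₂₃ (M : PRModel) : ℝ := 2 * M.G / (M.ω₁ * M.l₁ * M.k)

noncomputable def J₂₄ (M : PRModel) : ℝ := 2 * M.G / (M.ω₂ * M.l₂ * M.k)

/-- The matrix of the linear normalization `(x, y, p_x, p_y) = J (Q₁, Q₂, P₁, P₂)`. -/
noncomputable def J (M : PRModel) : Matrix (Fin 2 ⊕ Fin 2) (Fin 2 ⊕ Fin 2) ℝ :=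
  Matrix.fromBlocks
    !![0, 0;
       M.J₂₁, M.J₂₂]
    !![M.J₁₃, M.J₁₄;
       M.J₂₃, M.J₂₄]
    !![-M.ω₁ ^ 2 * M.J₁₃ - M.n * M.J₂₁, M.ω₂ ^ 2 * M.J₁₄ - M.n * M.J₂₂;
       -M.ω₁ ^ 2 * M.J₂₃, M.ω₂ ^ 2 * M.J₂₄]
    !![-M.n * M.J₂₃, -M.n * M.J₂₄;
       M.J₂₁ + M.n * M.J₁₃, -M.J₂₂ + M.n * M.J₁₄]

/-- The normal coordinates `T = (Q₁, Q₂, P₁, P₂)` in terms of action-angle variables. -/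
noncomputable def T (M : PRModel) (I₁ I₂ φ₁ φ₂ : ℝ) : Fin 2 ⊕ Fin 2 → ℝ :=
  Sum.elim
    ![√(2 * I₁ / M.ω₁) * Real.sin φ₁, √(2 * I₂ / M.ω₂) * Real.sin φ₂]
    ![√(2 * I₁ * M.ω₁) * Real.cos φ₁, √(2 * I₂ * M.ω₂) * Real.cos φ₂]

/-- The first order components `B₁^{1,0}`, `B₁^{0,1}`: the coordinates `x, y` of the linear
normal form. -/
noncomputable def B₁x (M : PRModel) : ActionAngleFun :=
  fun I₁ I₂ φ₁ φ₂ => Matrix.mulVec M.J (M.T I₁ I₂ φ₁ φ₂) (.inl 0)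

noncomputable def B₁y (M : PRModel) : ActionAngleFun :=
  fun I₁ I₂ φ₁ φ₂ => Matrix.mulVec M.J (M.T I₁ I₂ φ₁ φ₂) (.inl 1)

/-- The operator `D = ω₁ ∂/∂φ₁ - ω₂ ∂/∂φ₂`. -/
noncomputable def D (M : PRModel) (f : ActionAngleFun) : ActionAngleFun :=
  fun I₁ I₂ φ₁ φ₂ =>
    M.ω₁ * deriv (fun t => f I₁ I₂ t φ₂) φ₁ - M.ω₂ * deriv (fun t => f I₁ I₂ φ₁ t) φ₂

/-- A function of `(x, y, ẋ, ẏ)` evaluated along the first order components, where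
`ẋ = D B₁^{1,0}` and `ẏ = D B₁^{0,1}`. -/
noncomputable def alongFirstOrder (M : PRModel) (g : ℝ → ℝ → ℝ → ℝ → ℝ) : ActionAngleFun :=
  fun I₁ I₂ φ₁ φ₂ => g (M.B₁x I₁ I₂ φ₁ φ₂) (M.B₁y I₁ I₂ φ₁ φ₂)
    (M.D M.B₁x I₁ I₂ φ₁ φ₂) (M.D M.B₁y I₁ I₂ φ₁ φ₂)

/-- The contribution `X₂ = ∂L₃/∂x - d/dt (∂L₃/∂ẋ)` of `L₃` to Lagrange's equation for `x`, along
the first order components (on which `d/dt` is `D`). -/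
noncomputable def X₂ (M : PRModel) : ActionAngleFun :=
  fun I₁ I₂ φ₁ φ₂ =>
    M.alongFirstOrder (fun x y u v => deriv (fun t => M.Lpart 3 t y u v) x) I₁ I₂ φ₁ φ₂
    - M.D (M.alongFirstOrder (fun x y u v => deriv (fun t => M.Lpart 3 x y t v) u)) I₁ I₂ φ₁ φ₂

/-- The contribution `Y₂ = ∂L₃/∂y - d/dt (∂L₃/∂ẏ)` of `L₃` to Lagrange's equation for `y`. -/
noncomputable def Y₂ (M : PRModel) : ActionAngleFun :=
  fun I₁ I₂ φ₁ φ₂ =>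
    M.alongFirstOrder (fun x y u v => deriv (fun t => M.Lpart 3 x t u v) y) I₁ I₂ φ₁ φ₂
    - M.D (M.alongFirstOrder (fun x y u v => deriv (fun t => M.Lpart 3 x y u t) v)) I₁ I₂ φ₁ φ₂

/-- The two partial differential equations for the second order components:
`(D² + 2E - n²) Bx - (2nD - G) By = X₂` and `(2nD + G) Bx + (D² + 2F - n²) By = Y₂`. -/
def SolvesSecondOrder (M : PRModel) (Bx By : ActionAngleFun) : Prop :=
  ActionAngleFun.Agree
    (fun I₁ I₂ φ₁ φ₂ =>
      (M.D (M.D Bx) I₁ I₂ φ₁ φ₂ + (2 * M.E - M.n ^ 2) * Bx I₁ I₂ φ₁ φ₂)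
        - (2 * M.n * M.D By I₁ I₂ φ₁ φ₂ - M.G * By I₁ I₂ φ₁ φ₂)) M.X₂ ∧
  ActionAngleFun.Agree
    (fun I₁ I₂ φ₁ φ₂ =>
      (2 * M.n * M.D Bx I₁ I₂ φ₁ φ₂ + M.G * Bx I₁ I₂ φ₁ φ₂)
        + (M.D (M.D By) I₁ I₂ φ₁ φ₂ + (2 * M.F - M.n ^ 2) * By I₁ I₂ φ₁ φ₂)) M.Y₂

/-- `Φ₂ = (D² + 2F - n²) X₂ + (2nD - G) Y₂`. -/
noncomputable def Φ₂ (M : PRModel) : ActionAngleFun :=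
  fun I₁ I₂ φ₁ φ₂ =>
    (M.D (M.D M.X₂) I₁ I₂ φ₁ φ₂ + (2 * M.F - M.n ^ 2) * M.X₂ I₁ I₂ φ₁ φ₂)
      + (2 * M.n * M.D M.Y₂ I₁ I₂ φ₁ φ₂ - M.G * M.Y₂ I₁ I₂ φ₁ φ₂)

/-- `Ψ₂ = (2nD + G) X₂ - (D² + 2E - n²) Y₂`. -/
noncomputable def Ψ₂ (M : PRModel) : ActionAngleFun :=
  fun I₁ I₂ φ₁ φ₂ =>
    (2 * M.n * M.D M.X₂ I₁ I₂ φ₁ φ₂ + M.G * M.X₂ I₁ I₂ φ₁ φ₂)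
      - (M.D (M.D M.Y₂) I₁ I₂ φ₁ φ₂ + (2 * M.E - M.n ^ 2) * M.Y₂ I₁ I₂ φ₁ φ₂)

/-- The divisor `Δ_{p,q} = [ω₁² - (ω₁p - ω₂q)²] [ω₂² - (ω₁p - ω₂q)²]`. -/
noncomputable def Δ (M : PRModel) (p : ℕ) (q : ℤ) : ℝ :=
  (M.ω₁ ^ 2 - (M.ω₁ * p - M.ω₂ * q) ^ 2) * (M.ω₂ ^ 2 - (M.ω₁ * p - M.ω₂ * q) ^ 2)

/-- The third order part, in `I₁^{1/2}, I₂^{1/2}`, of the Hamiltonian after the substitution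
`x = B₁^{1,0} + Bx`, `y = B₁^{0,1} + By` (in the shifted coordinates), with
`ẋ = D B₁^{1,0} + D Bx`, `ẏ = D B₁^{0,1} + D By`, where `Bx, By` are homogeneous of degree 2.
Replacing `I₁^{1/2}, I₂^{1/2}` by `s I₁^{1/2}, s I₂^{1/2}` multiplies the components of degree 1
and 2 by `s` and `s²`; the third order part is the coefficient of `s³`. -/
noncomputable def H₃ (M : PRModel) (Bx By : ActionAngleFun) : ActionAngleFun :=
  fun I₁ I₂ φ₁ φ₂ =>
    iteratedDeriv 3 (fun s : ℝ => M.H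
      (M.xs + (s * M.B₁x I₁ I₂ φ₁ φ₂ + s ^ 2 * Bx I₁ I₂ φ₁ φ₂))
      (M.ys + (s * M.B₁y I₁ I₂ φ₁ φ₂ + s ^ 2 * By I₁ I₂ φ₁ φ₂))
      (s * M.D M.B₁x I₁ I₂ φ₁ φ₂ + s ^ 2 * M.D Bx I₁ I₂ φ₁ φ₂)
      (s * M.D M.B₁y I₁ I₂ φ₁ φ₂ + s ^ 2 * M.D By I₁ I₂ φ₁ φ₂)) 0 / (Nat.factorial 3 : ℝ)

end PRModel

/-! The vanishing of the third-order part of `H` is conservation of energy plus non-resonance. The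
terms of `L` that are linear in the velocities drop out of the Hamiltonian, so `H` is kinetic energy
minus the potential part `V` (`H_eq`). Pairing the linear equations for the first-order components
with the second-order velocities, and the second-order equations with the first-order velocities,
gives `D H₃ = 0`. Now `H₃` is a D'Alembert component of degree 3, and in odd degree no harmonic has
frequency zero under `D` (`freq_ne_zero_of_degree_three`); hence `H₃ = 0` (`IsJet.H₃_agree_zero`).

For this to work, the drag must not spoil the second-order equations. Its velocity-dependent part is
the one-form `(W₁/2) d log r₁`, which is closed. Its cubic contribution to `L₃` is therefore a total
time derivative and cancels in `X₂` and `Y₂`, which reduce to the gradient of the cubic part of `V`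
(`IsJet.X₂_agree`, `IsJet.Y₂_agree`).

The second-order system has constant coefficients in `D`. Its determinant at a harmonic is the
divisor `Δ`, by Vieta's formulas for the frequencies (`Δ_eq`), and `Φ₂`, `-Ψ₂` come from its
adjugate. Non-resonance makes `Δ` nonzero, which gives existence by division. The coefficients of a
component are not determined by the function, since for `p = 0` the indices `q` and `-q` give the
same harmonics up to sign. Uniqueness is therefore proved for functions: a nonvanishing multiplier
in `-D²` is inverted by an interpolating polynomial in `-D²`
(`dAlembertComp_eq_zero_of_multiplier`).

The linear normal form needs positive radicands in `l₁`, `l₂`. The Laplacian of `V` is positive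
because the arctangent is harmonic and negative powers of the distances are subharmonic, so `E + F <
n²`. Together with the positive product of the squared frequencies this yields `2F < n²`
(`two_F_lt`). The radicals are then hidden in two factors `s₁`, `s₂`, and every assertion about `J`
becomes a polynomial identity. -/

open Filter
open scoped Topology ContDiff

/-! ### Second and third derivatives along curves in the plane. -/

theorem iteratedDeriv_two_of_hasDerivAt {f g : ℝ → ℝ} {a c : ℝ}
    (hf : ∀ᶠ s in 𝓝 a, HasDerivAt f (g s) s) (hg : HasDerivAt g c a) :
    iteratedDeriv 2 f a = c := by
  have h : deriv f =ᶠ[𝓝 a] g := hf.mono fun s hs => hs.deriv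
  rw [iteratedDeriv_succ, iteratedDeriv_one, h.deriv_eq, hg.deriv]

theorem iteratedDeriv_three_of_hasDerivAt {f g h : ℝ → ℝ} {a c : ℝ}
    (hf : ∀ᶠ s in 𝓝 a, HasDerivAt f (g s) s) (hg : ∀ᶠ s in 𝓝 a, HasDerivAt g (h s) s)
    (hh : HasDerivAt h c a) : iteratedDeriv 3 f a = c := by
  have h1 : deriv f =ᶠ[𝓝 a] g := hf.mono fun s hs => hs.deriv
  rw [iteratedDeriv_succ', h1.iteratedDeriv_eq, iteratedDeriv_two_of_hasDerivAt hg hh]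

/-- Partial derivatives of a function on the plane. -/
noncomputable def partialX (f : ℝ × ℝ → ℝ) (z : ℝ × ℝ) : ℝ := fderiv ℝ f z (1, 0)

noncomputable def partialY (f : ℝ × ℝ → ℝ) (z : ℝ × ℝ) : ℝ := fderiv ℝ f z (0, 1)

theorem ContDiffAt.partialX {f : ℝ × ℝ → ℝ} {z : ℝ × ℝ} (hf : ContDiffAt ℝ ω f z) :
    ContDiffAt ℝ ω (partialX f) z :=
  (hf.fderiv_right (m := ω) (by simp)).clm_apply contDiffAt_const

theorem ContDiffAt.partialY {f : ℝ × ℝ → ℝ} {z : ℝ × ℝ} (hf : ContDiffAt ℝ ω f z) :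
    ContDiffAt ℝ ω (partialY f) z :=
  (hf.fderiv_right (m := ω) (by simp)).clm_apply contDiffAt_const

theorem partialX_partialY_comm {f : ℝ × ℝ → ℝ} {z : ℝ × ℝ} (hf : ContDiffAt ℝ ω f z) :
    partialX (partialY f) z = partialY (partialX f) z := by
  have hd : DifferentiableAt ℝ (fderiv ℝ f) z :=
    (hf.fderiv_right (m := ω) (by simp)).differentiableAt (by simp)
  have h := hf.isSymmSndFDerivAt (by simp) (1, 0) (0, 1)
  have e1 : partialX (partialY f) z = fderiv ℝ (fderiv ℝ f) z (1, 0) (0, 1) := by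
    unfold partialX partialY
    rw [fderiv_clm_apply hd (differentiableAt_const _)]
    simp
  have e2 : partialY (partialX f) z = fderiv ℝ (fderiv ℝ f) z (0, 1) (1, 0) := by
    unfold partialX partialY
    rw [fderiv_clm_apply hd (differentiableAt_const _)]
    simp
  rw [e1, e2, h]

theorem DifferentiableAt.hasDerivAt_comp_prodMk {f : ℝ × ℝ → ℝ} {α β : ℝ → ℝ} {s α' β' : ℝ}
    (hf : DifferentiableAt ℝ f (α s, β s)) (hα : HasDerivAt α α' s) (hβ : HasDerivAt β β' s) :
    HasDerivAt (fun t => f (α t, β t))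
      (_root_.partialX f (α s, β s) * α' + _root_.partialY f (α s, β s) * β') s := by
  have h := HasFDerivAt.comp_hasDerivAt (f := fun t => (α t, β t)) s hf.hasFDerivAt
    (hα.prodMk hβ)
  refine HasDerivAt.congr_deriv (f := fun t => f (α t, β t)) h ?_
  have e : ((α', β') : ℝ × ℝ) = α' • (1, 0) + β' • (0, 1) := by simp
  rw [e, map_add, map_smul, map_smul]
  simp [_root_.partialX, _root_.partialY, mul_comm]

theorem HasDerivAt.partialX_eq {f : ℝ × ℝ → ℝ} {x y c : ℝ}
    (h : HasDerivAt (fun t => f (t, y)) c x) (hf : DifferentiableAt ℝ f (x, y)) :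
    _root_.partialX f (x, y) = c := by
  have := DifferentiableAt.hasDerivAt_comp_prodMk (α := fun t => t) (β := fun _ => y) hf
    (hasDerivAt_id x) (hasDerivAt_const x y)
  simpa using this.unique h

theorem HasDerivAt.partialY_eq {f : ℝ × ℝ → ℝ} {x y c : ℝ}
    (h : HasDerivAt (fun t => f (x, t)) c y) (hf : DifferentiableAt ℝ f (x, y)) :
    _root_.partialY f (x, y) = c := by
  have := DifferentiableAt.hasDerivAt_comp_prodMk (α := fun _ => x) (β := fun t => t) hf
    (hasDerivAt_const y x) (hasDerivAt_id y)
  simpa using this.unique h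

section Curve

variable {f : ℝ × ℝ → ℝ} {a b : ℝ}

theorem hasDerivAt_quadratic (a x x' s : ℝ) :
    HasDerivAt (fun t : ℝ => a + (t * x + t ^ 2 * x')) (x + 2 * s * x') s := by
  have := (((hasDerivAt_id s).mul_const x).add ((hasDerivAt_pow 2 s).mul_const x')).const_add a
  simpa using this

theorem hasDerivAt_quadratic_deriv (x x' s : ℝ) :
    HasDerivAt (fun t : ℝ => x + 2 * t * x') (2 * x') s := by
  have := (((hasDerivAt_id s).const_mul 2).mul_const x').const_add x
  simpa using this

theorem tendsto_quadratic_curve (a b x y x' y' : ℝ) :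
    Tendsto (fun s : ℝ => (a + (s * x + s ^ 2 * x'), b + (s * y + s ^ 2 * y'))) (𝓝 0)
      (𝓝 (a, b)) := by
  have : Continuous (fun s : ℝ => (a + (s * x + s ^ 2 * x'), b + (s * y + s ^ 2 * y'))) := by
    fun_prop
  simpa using this.tendsto 0

/-- First and second derivative of a smooth function along a quadratic curve. -/
theorem eventually_hasDerivAt_curve (hf : ContDiffAt ℝ ω f (a, b)) (x y x' y' : ℝ) :
    ∀ᶠ s in 𝓝 (0 : ℝ),
      HasDerivAt (fun t => f (a + (t * x + t ^ 2 * x'), b + (t * y + t ^ 2 * y')))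
        (partialX f (a + (s * x + s ^ 2 * x'), b + (s * y + s ^ 2 * y')) * (x + 2 * s * x')
          + partialY f (a + (s * x + s ^ 2 * x'), b + (s * y + s ^ 2 * y')) * (y + 2 * s * y'))
        s := by
  have h := (tendsto_quadratic_curve a b x y x' y').eventually (hf.eventually (by simp))
  filter_upwards [h] with s hs
  exact DifferentiableAt.hasDerivAt_comp_prodMk (hs.differentiableAt (by simp))
    (hasDerivAt_quadratic a x x' s) (hasDerivAt_quadratic b y y' s)

theorem eventually_hasDerivAt_curve_deriv (hf : ContDiffAt ℝ ω f (a, b)) (x y x' y' : ℝ) :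
    ∀ᶠ s in 𝓝 (0 : ℝ),
      HasDerivAt (fun s =>
        partialX f (a + (s * x + s ^ 2 * x'), b + (s * y + s ^ 2 * y')) * (x + 2 * s * x')
          + partialY f (a + (s * x + s ^ 2 * x'), b + (s * y + s ^ 2 * y')) * (y + 2 * s * y'))
        (partialX (partialX f) (a + (s * x + s ^ 2 * x'), b + (s * y + s ^ 2 * y'))
            * (x + 2 * s * x') ^ 2
          + 2 * partialY (partialX f) (a + (s * x + s ^ 2 * x'), b + (s * y + s ^ 2 * y'))
            * ((x + 2 * s * x') * (y + 2 * s * y'))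
          + partialY (partialY f) (a + (s * x + s ^ 2 * x'), b + (s * y + s ^ 2 * y'))
            * (y + 2 * s * y') ^ 2
          + partialX f (a + (s * x + s ^ 2 * x'), b + (s * y + s ^ 2 * y')) * (2 * x')
          + partialY f (a + (s * x + s ^ 2 * x'), b + (s * y + s ^ 2 * y')) * (2 * y'))
        s := by
  have h := (tendsto_quadratic_curve a b x y x' y').eventually (hf.eventually (by simp))
  filter_upwards [h, eventually_hasDerivAt_curve hf.partialX x y x' y',
    eventually_hasDerivAt_curve hf.partialY x y x' y'] with s hs h1 h2
  have h3 := (h1.mul (hasDerivAt_quadratic_deriv x x' s)).add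
    (h2.mul (hasDerivAt_quadratic_deriv y y' s))
  refine h3.congr_deriv ?_
  rw [partialX_partialY_comm hs]
  ring

theorem iteratedDeriv_two_curve (hf : ContDiffAt ℝ ω f (a, b)) (x y : ℝ) :
    iteratedDeriv 2 (fun s : ℝ => f (a + s * x, b + s * y)) 0
      = partialX (partialX f) (a, b) * x ^ 2 + 2 * partialY (partialX f) (a, b) * (x * y)
        + partialY (partialY f) (a, b) * y ^ 2 := by
  -- A straight line is the quadratic curve with zero acceleration.
  have h := iteratedDeriv_two_of_hasDerivAt (eventually_hasDerivAt_curve hf x y 0 0)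
    (eventually_hasDerivAt_curve_deriv hf x y 0 0).self_of_nhds
  simpa using h

/-- The curve models the substitution of components of orders one and two. Its coefficient of `s³`
consists of the cubic form at `(x, y)` and the quadratic form polarised between `(x, y)` and `(x',
y')`; first derivatives drop out because the curve has no cubic term. -/
theorem iteratedDeriv_three_curve (hf : ContDiffAt ℝ ω f (a, b)) (x y x' y' : ℝ) :
    iteratedDeriv 3
        (fun s : ℝ => f (a + (s * x + s ^ 2 * x'), b + (s * y + s ^ 2 * y'))) 0
      = partialX (partialX (partialX f)) (a, b) * x ^ 3
        + 3 * partialY (partialX (partialX f)) (a, b) * (x ^ 2 * y)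
        + 3 * partialY (partialY (partialX f)) (a, b) * (x * y ^ 2)
        + partialY (partialY (partialY f)) (a, b) * y ^ 3
        + 6 * (partialX (partialX f) (a, b) * (x * x')
          + partialY (partialX f) (a, b) * (x * y' + y * x')
          + partialY (partialY f) (a, b) * (y * y')) := by
  refine iteratedDeriv_three_of_hasDerivAt (eventually_hasDerivAt_curve hf x y x' y')
    (eventually_hasDerivAt_curve_deriv hf x y x' y') ?_
  have ex := hasDerivAt_quadratic_deriv x x' 0
  have ey := hasDerivAt_quadratic_deriv y y' 0
  have h1 := (eventually_hasDerivAt_curve hf.partialX x y x' y').self_of_nhds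
  have h2 := (eventually_hasDerivAt_curve hf.partialY x y x' y').self_of_nhds
  have h11 := (eventually_hasDerivAt_curve hf.partialX.partialX x y x' y').self_of_nhds
  have h12 := (eventually_hasDerivAt_curve hf.partialX.partialY x y x' y').self_of_nhds
  have h22 := (eventually_hasDerivAt_curve hf.partialY.partialY x y x' y').self_of_nhds
  have h := ((((h11.mul (ex.pow 2)).add ((h12.const_mul 2).mul (ex.mul ey))).add
    (h22.mul (ey.pow 2))).add (h1.mul_const (2 * x'))).add (h2.mul_const (2 * y'))
  refine h.congr_deriv ?_
  have c1 := partialX_partialY_comm hf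
  have c2 := partialX_partialY_comm hf.partialX
  have c3 : partialX (partialY (partialY f)) (a, b) = partialY (partialY (partialX f)) (a, b) := by
    rw [partialX_partialY_comm hf.partialY]
    -- One more derivative follows, so the mixed partials must agree on a neighbourhood.
    have : partialX (partialY f) =ᶠ[𝓝 (a, b)] partialY (partialX f) :=
      (hf.eventually (by simp)).mono fun z hz => partialX_partialY_comm hz
    rw [partialY, this.fderiv_eq, ← partialY]
  simp only [Pi.mul_apply, Pi.pow_apply, mul_zero, zero_mul, add_zero, ne_eq, OfNat.ofNat_ne_zero,
    not_false_eq_true, zero_pow, Nat.cast_ofNat, Nat.add_one_sub_one, pow_one]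
  rw [c1, c2, c3]
  ring

/-- The quadratic and cubic terms of the Taylor expansion in the plane. -/
theorem exists_cubic_jet (hf : ContDiffAt ℝ ω f (a, b)) :
    ∃ c₂₀ c₁₁ c₀₂ c₃₀ c₂₁ c₁₂ c₀₃ : ℝ,
      (∀ x y, iteratedDeriv 2 (fun s : ℝ => f (a + s * x, b + s * y)) 0
        = 2 * (c₂₀ * x ^ 2 + c₁₁ * (x * y) + c₀₂ * y ^ 2)) ∧
      (∀ x y x' y', iteratedDeriv 3
          (fun s : ℝ => f (a + (s * x + s ^ 2 * x'), b + (s * y + s ^ 2 * y'))) 0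
        = 6 * (c₃₀ * x ^ 3 + c₂₁ * (x ^ 2 * y) + c₁₂ * (x * y ^ 2) + c₀₃ * y ^ 3
          + 2 * c₂₀ * (x * x') + c₁₁ * (x * y' + y * x') + 2 * c₀₂ * (y * y'))) := by
  refine ⟨partialX (partialX f) (a, b) / 2, partialY (partialX f) (a, b),
    partialY (partialY f) (a, b) / 2, partialX (partialX (partialX f)) (a, b) / 6,
    partialY (partialX (partialX f)) (a, b) / 2, partialY (partialY (partialX f)) (a, b) / 2,
    partialY (partialY (partialY f)) (a, b) / 6, fun x y => ?_, fun x y x' y' => ?_⟩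
  · rw [iteratedDeriv_two_curve hf]; ring
  · rw [iteratedDeriv_three_curve hf]; ring

theorem analyticAt_curve (hf : ContDiffAt ℝ ω f (a, b)) (x y : ℝ) :
    AnalyticAt ℝ (fun s : ℝ => f (a + s * x, b + s * y)) 0 := by
  have h : ContDiffAt ℝ ω (fun s : ℝ => (a + s * x, b + s * y)) 0 := by fun_prop
  have hf' : ContDiffAt ℝ ω f ((fun s : ℝ => (a + s * x, b + s * y)) 0) := by simpa using hf
  exact (hf'.comp (0 : ℝ) h).analyticAt

end Curve

theorem AnalyticAt.eventually_hasDerivAt {g : ℝ → ℝ} {a : ℝ} (hg : AnalyticAt ℝ g a) :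
    ∀ᶠ s in 𝓝 a, HasDerivAt g (deriv g s) s :=
  hg.eventually_analyticAt.mono fun _ hs => hs.differentiableAt.hasDerivAt

/-- Third derivative at `0` of a quadratic polynomial plus an analytic function plus `s` times two
analytic functions. -/
theorem iteratedDeriv_three_add_mul {f g h : ℝ → ℝ} (hf : AnalyticAt ℝ f 0)
    (hg : AnalyticAt ℝ g 0) (hh : AnalyticAt ℝ h 0) (c d u v : ℝ) :
    iteratedDeriv 3 (fun s : ℝ => f s + (c * s + d * s ^ 2) + s * (g s * u + h s * v)) 0
      = iteratedDeriv 3 f 0 + 3 * (iteratedDeriv 2 g 0 * u + iteratedDeriv 2 h 0 * v) := by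
  have f0 := hf.eventually_hasDerivAt
  have f1 := hf.deriv.eventually_hasDerivAt
  have f2 := hf.deriv.deriv.eventually_hasDerivAt.self_of_nhds
  have g0 := hg.eventually_hasDerivAt
  have g1 := hg.deriv.eventually_hasDerivAt
  have g2 := hg.deriv.deriv.eventually_hasDerivAt.self_of_nhds
  have h0 := hh.eventually_hasDerivAt
  have h1 := hh.deriv.eventually_hasDerivAt
  have h2 := hh.deriv.deriv.eventually_hasDerivAt.self_of_nhds
  have hk (s : ℝ) := hasDerivAt_id' s
  have hq (s : ℝ) : HasDerivAt (fun s : ℝ => c * s + d * s ^ 2) (c + d * (2 * s)) s := by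
    exact (((hk s).const_mul c).add ((hasDerivAt_pow 2 s).const_mul d)).congr_deriv (by simp)
  have hq' (s : ℝ) : HasDerivAt (fun s : ℝ => c + d * (2 * s)) (d * 2) s := by
    simpa using (((hk s).const_mul 2).const_mul d).const_add c
  rw [iteratedDeriv_three_of_hasDerivAt f0 f1 f2, iteratedDeriv_two_of_hasDerivAt g0
    g1.self_of_nhds, iteratedDeriv_two_of_hasDerivAt h0 h1.self_of_nhds]
  refine iteratedDeriv_three_of_hasDerivAt
    (g := fun s => deriv f s + (c + d * (2 * s)) + ((g s * u + h s * v)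
      + s * (deriv g s * u + deriv h s * v)))
    (h := fun s => deriv (deriv f) s + d * 2 + ((deriv g s * u + deriv h s * v)
      + ((deriv g s * u + deriv h s * v) + s * (deriv (deriv g) s * u + deriv (deriv h) s * v))))
    ?_ ?_ ?_
  · filter_upwards [f0, g0, h0] with s a b e
    refine ((a.add (hq s)).add ((hk s).mul ((b.mul_const u).add (e.mul_const v)))).congr_deriv ?_
    simp
  · filter_upwards [f1, g0, h0, g1, h1] with s a b e b' e'
    refine ((a.add (hq' s)).add (((b.mul_const u).add (e.mul_const v)).add
      ((hk s).mul ((b'.mul_const u).add (e'.mul_const v))))).congr_deriv ?_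
    simp
  · have b := (g1.self_of_nhds.mul_const u).add (h1.self_of_nhds.mul_const v)
    refine ((f2.add_const (d * 2)).add (b.add (b.add
      ((hk 0).mul ((g2.mul_const u).add (h2.mul_const v)))))).congr_deriv ?_
    simp
    ring

/-- The quadratic terms of the Taylor expansion of a closed one-form in the plane. -/
theorem exists_quadratic_jet_of_closed {f g : ℝ × ℝ → ℝ} {a b : ℝ}
    (hf : ContDiffAt ℝ ω f (a, b)) (hg : ContDiffAt ℝ ω g (a, b))
    (h : partialY f =ᶠ[𝓝 (a, b)] partialX g) :
    ∃ c d e k : ℝ,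
      (∀ x y, iteratedDeriv 2 (fun s : ℝ => f (a + s * x, b + s * y)) 0
        = 2 * (c * x ^ 2 + 2 * d * (x * y) + e * y ^ 2)) ∧
      (∀ x y, iteratedDeriv 2 (fun s : ℝ => g (a + s * x, b + s * y)) 0
        = 2 * (d * x ^ 2 + 2 * e * (x * y) + k * y ^ 2)) := by
  refine ⟨partialX (partialX f) (a, b) / 2, partialY (partialX f) (a, b) / 2,
    partialY (partialY f) (a, b) / 2, partialY (partialY g) (a, b) / 2, fun x y => ?_,
    fun x y => ?_⟩
  · rw [iteratedDeriv_two_curve hf]; ring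
  -- Differentiating the closedness relation identifies the first two coefficients of the jet of `g`
  -- with the last two of the jet of `f`.
  · have h1 : partialX (partialX g) (a, b) = partialY (partialX f) (a, b) := by
      rw [← partialX_partialY_comm hf, partialX, ← h.fderiv_eq, ← partialX]
    have h2 : partialY (partialX g) (a, b) = partialY (partialY f) (a, b) := by
      rw [partialY, ← h.fderiv_eq, ← partialY]
    rw [iteratedDeriv_two_curve hg, h1, h2]; ring

/-! ### The algebra of D'Alembert components. -/

section DAlembert

variable {k l : ℕ} {C S C' S' : ℕ → ℕ → ℤ → ℝ}

theorem dAlembertComp_congr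
    (h : ∀ m ∈ Finset.range (k + 1), ∀ p ∈ dAlembertP (k - m), ∀ q ∈ dAlembertQ m,
      C m p q = C' m p q ∧ S m p q = S' m p q) :
    dAlembertComp k C S = dAlembertComp k C' S' := by
  funext I₁ I₂ φ₁ φ₂
  refine Finset.sum_congr rfl fun m hm => ?_
  congr 1
  refine Finset.sum_congr rfl fun p hp => Finset.sum_congr rfl fun q hq => ?_
  rw [(h m hm p hp q hq).1, (h m hm p hp q hq).2]

theorem dAlembertComp_add (k : ℕ) (C S C' S' : ℕ → ℕ → ℤ → ℝ) :
    dAlembertComp k C S + dAlembertComp k C' S' = dAlembertComp k (C + C') (S + S') := by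
  funext I₁ I₂ φ₁ φ₂
  simp only [dAlembertComp, Pi.add_apply, ← Finset.sum_add_distrib, ← mul_add]
  refine Finset.sum_congr rfl fun m _ => ?_
  congr 1
  refine Finset.sum_congr rfl fun p _ => Finset.sum_congr rfl fun q _ => ?_
  ring

theorem dAlembertComp_smul (k : ℕ) (C S : ℕ → ℕ → ℤ → ℝ) (r : ℝ) :
    r • dAlembertComp k C S = dAlembertComp k (r • C) (r • S) := by
  funext I₁ I₂ φ₁ φ₂
  simp only [dAlembertComp, Pi.smul_apply, smul_eq_mul, Finset.mul_sum]
  refine Finset.sum_congr rfl fun m _ => Finset.sum_congr rfl fun p _ =>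
    Finset.sum_congr rfl fun q _ => ?_
  ring

theorem dAlembertComp_zero (k : ℕ) : dAlembertComp k 0 0 = 0 := by
  have h := dAlembertComp_smul k 0 0 0
  rwa [zero_smul, smul_zero, eq_comm] at h

/-- The actions enter only through `√I`, which equals `√(max I 0)`; agreement on nonnegative actions
therefore extends to all real ones. -/
theorem dAlembertComp_eq_of_agree (h : (dAlembertComp k C S).Agree (dAlembertComp l C' S')) :
    dAlembertComp k C S = dAlembertComp l C' S' := by
  have e (I : ℝ) : √I = √(max I 0) := by
    rcases le_total 0 I with hI | hI
    · rw [max_eq_left hI]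
    · rw [max_eq_right hI, Real.sqrt_eq_zero_of_nonpos hI, Real.sqrt_zero]
  funext I₁ I₂ φ₁ φ₂
  have := h (max I₁ 0) (max I₂ 0) φ₁ φ₂ (le_max_right _ _) (le_max_right _ _)
  simp only [dAlembertComp] at this ⊢
  rwa [e I₁, e I₂]

theorem hasDerivAt_dAlembertComp_fst (k : ℕ) (C S : ℕ → ℕ → ℤ → ℝ) (I₁ I₂ φ₁ φ₂ : ℝ) :
    HasDerivAt (fun t => dAlembertComp k C S I₁ I₂ t φ₂)
      (dAlembertComp k (fun m p q => p * S m p q) (fun m p q => -(p * C m p q)) I₁ I₂ φ₁ φ₂)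
      φ₁ := by
  refine HasDerivAt.fun_sum fun m _ => (HasDerivAt.fun_sum fun p _ => HasDerivAt.fun_sum
    fun q _ => ?_).const_mul _
  have h : HasDerivAt (fun t : ℝ => (p : ℝ) * t + q * φ₂) p φ₁ := by
    simpa using ((hasDerivAt_id' φ₁).const_mul (p : ℝ)).add_const (q * φ₂)
  exact ((h.cos.const_mul (C m p q)).add (h.sin.const_mul (S m p q))).congr_deriv (by ring)

theorem hasDerivAt_dAlembertComp_snd (k : ℕ) (C S : ℕ → ℕ → ℤ → ℝ) (I₁ I₂ φ₁ φ₂ : ℝ) :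
    HasDerivAt (fun t => dAlembertComp k C S I₁ I₂ φ₁ t)
      (dAlembertComp k (fun m p q => q * S m p q) (fun m p q => -(q * C m p q)) I₁ I₂ φ₁ φ₂)
      φ₂ := by
  refine HasDerivAt.fun_sum fun m _ => (HasDerivAt.fun_sum fun p _ => HasDerivAt.fun_sum
    fun q _ => ?_).const_mul _
  have h : HasDerivAt (fun t : ℝ => (p : ℝ) * φ₁ + q * t) q φ₂ := by
    simpa using ((hasDerivAt_id' φ₂).const_mul (q : ℝ)).const_add (p * φ₁)
  exact ((h.cos.const_mul (C m p q)).add (h.sin.const_mul (S m p q))).congr_deriv (by ring)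

/-- The monomial `I₁^{a/2} I₂^{m/2} cos (p φ₁ + q φ₂)`. -/
noncomputable def cosMonomial (a m : ℕ) (p q : ℤ) : ActionAngleFun :=
  fun I₁ I₂ φ₁ φ₂ => √I₁ ^ a * √I₂ ^ m * Real.cos (p * φ₁ + q * φ₂)

noncomputable def sinMonomial (a m : ℕ) (p q : ℤ) : ActionAngleFun :=
  fun I₁ I₂ φ₁ φ₂ => √I₁ ^ a * √I₂ ^ m * Real.sin (p * φ₁ + q * φ₂)

theorem mem_dAlembertP {a p : ℕ} : p ∈ dAlembertP a ↔ p ≤ a ∧ p % 2 = a % 2 := by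
  simp [dAlembertP]

theorem mem_dAlembertQ {m : ℕ} {q : ℤ} :
    q ∈ dAlembertQ m ↔ (-(m : ℤ) ≤ q ∧ q ≤ m) ∧ q % 2 = (m : ℤ) % 2 := by
  simp [dAlembertQ]

/-- `(p, q)` is, up to the sign of `p`, an index belonging to `I₁^{a/2} I₂^{m/2}`. -/
def IsDAlembertIndex (a m : ℕ) (p q : ℤ) : Prop :=
  (|p| ≤ a ∧ p % 2 = (a : ℤ) % 2) ∧ |q| ≤ m ∧ q % 2 = (m : ℤ) % 2

theorem isDAlembertIndex_of_mem {a m p : ℕ} {q : ℤ} (hp : p ∈ dAlembertP a)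
    (hq : q ∈ dAlembertQ m) : IsDAlembertIndex a m p q := by
  rw [mem_dAlembertP] at hp
  rw [mem_dAlembertQ] at hq
  refine ⟨⟨?_, ?_⟩, abs_le.2 hq.1, hq.2⟩
  · rw [abs_le]; omega
  · omega

theorem dAlembertComp_eq_sum (k : ℕ) (C S : ℕ → ℕ → ℤ → ℝ) :
    dAlembertComp k C S = ∑ m ∈ Finset.range (k + 1), ∑ p ∈ dAlembertP (k - m),
      ∑ q ∈ dAlembertQ m,
        (C m p q • cosMonomial (k - m) m p q + S m p q • sinMonomial (k - m) m p q) := by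
  funext I₁ I₂ φ₁ φ₂
  simp only [dAlembertComp, Finset.sum_apply, Finset.mul_sum, Pi.add_apply, Pi.smul_apply,
    smul_eq_mul, cosMonomial, sinMonomial, Int.cast_natCast]
  refine Finset.sum_congr rfl fun m _ => Finset.sum_congr rfl fun p _ =>
    Finset.sum_congr rfl fun q _ => ?_
  ring

theorem dAlembertComp_single {a m p : ℕ} {q : ℤ} (hp : p ∈ dAlembertP a)
    (hq : q ∈ dAlembertQ m) (c s : ℝ) :
    dAlembertComp (a + m) (Pi.single m (Pi.single p (Pi.single q c)))
        (Pi.single m (Pi.single p (Pi.single q s)))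
      = c • cosMonomial a m p q + s • sinMonomial a m p q := by
  have ha : a + m - m = a := by omega
  rw [dAlembertComp_eq_sum, Finset.sum_eq_single m, Finset.sum_eq_single p,
    Finset.sum_eq_single q]
  · simp [ha]
  · intro q' _ h
    simp [h]
  · exact fun h => (h hq).elim
  · intro p' _ h
    simp [h]
  · exact fun h => (h (by rwa [ha])).elim
  · intro m' _ h
    simp [h]
  · exact fun h => (h (by simp)).elim

namespace IsDAlembertComp

variable {f g : ActionAngleFun}

theorem congr (hf : IsDAlembertComp k f) (h : g.Agree f) : IsDAlembertComp k g := by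
  obtain ⟨C, S, hCS⟩ := hf
  exact ⟨C, S, fun I₁ I₂ φ₁ φ₂ h₁ h₂ => (h _ _ _ _ h₁ h₂).trans (hCS _ _ _ _ h₁ h₂)⟩

theorem dAlembertComp (k : ℕ) (C S : ℕ → ℕ → ℤ → ℝ) :
    IsDAlembertComp k (dAlembertComp k C S) :=
  ⟨C, S, fun _ _ _ _ _ _ => rfl⟩

theorem zero (k : ℕ) : IsDAlembertComp k 0 :=
  dAlembertComp_zero k ▸ dAlembertComp k 0 0

theorem add (hf : IsDAlembertComp k f) (hg : IsDAlembertComp k g) :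
    IsDAlembertComp k (f + g) := by
  obtain ⟨C, S, h⟩ := hf
  obtain ⟨C', S', h'⟩ := hg
  refine ⟨C + C', S + S', fun I₁ I₂ φ₁ φ₂ h₁ h₂ => ?_⟩
  rw [← dAlembertComp_add]
  exact congrArg₂ (· + ·) (h _ _ _ _ h₁ h₂) (h' _ _ _ _ h₁ h₂)

theorem smul (hf : IsDAlembertComp k f) (r : ℝ) : IsDAlembertComp k (r • f) := by
  obtain ⟨C, S, h⟩ := hf
  refine ⟨r • C, r • S, fun I₁ I₂ φ₁ φ₂ h₁ h₂ => ?_⟩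
  rw [← dAlembertComp_smul]
  exact congrArg (r * ·) (h _ _ _ _ h₁ h₂)

theorem cosMonomial_of_mem {a m p : ℕ} {q : ℤ} (hp : p ∈ dAlembertP a)
    (hq : q ∈ dAlembertQ m) : IsDAlembertComp (a + m) (cosMonomial a m p q) := by
  have h := dAlembertComp_single hp hq 1 0
  rw [one_smul, zero_smul, add_zero] at h
  exact h ▸ dAlembertComp _ _ _

theorem sinMonomial_of_mem {a m p : ℕ} {q : ℤ} (hp : p ∈ dAlembertP a)
    (hq : q ∈ dAlembertQ m) : IsDAlembertComp (a + m) (sinMonomial a m p q) := by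
  have h := dAlembertComp_single hp hq 0 1
  rw [one_smul, zero_smul, zero_add] at h
  exact h ▸ dAlembertComp _ _ _

/-- Product formulas produce differences `p - p'`, possibly negative. The parity of cosine and sine
replaces `(p, q)` by `(-p, -q)`, which is admissible because the range of `q` is symmetric. -/
theorem monomial {a m : ℕ} {p q : ℤ} (h : IsDAlembertIndex a m p q) :
    IsDAlembertComp (a + m) (cosMonomial a m p q) ∧
      IsDAlembertComp (a + m) (sinMonomial a m p q) := by
  obtain ⟨⟨hp, hp'⟩, hq, hq'⟩ := h
  rw [abs_le] at hp hq
  rcases le_total 0 p with h0 | h0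
  · lift p to ℕ using h0
    have h1 : p ∈ dAlembertP a := mem_dAlembertP.2 (by omega)
    have h2 : q ∈ dAlembertQ m := mem_dAlembertQ.2 ⟨hq, hq'⟩
    exact ⟨cosMonomial_of_mem h1 h2, sinMonomial_of_mem h1 h2⟩
  · obtain ⟨r, hr⟩ : ∃ r : ℕ, p = -(r : ℤ) := ⟨p.natAbs, by omega⟩
    subst hr
    have h1 : r ∈ dAlembertP a := mem_dAlembertP.2 (by omega)
    have h2 : -q ∈ dAlembertQ m := mem_dAlembertQ.2 ⟨by omega, by omega⟩
    have e (x y : ℝ) : ((-(r : ℤ) : ℤ) : ℝ) * x + q * y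
        = -(((r : ℤ) : ℝ) * x + ((-q : ℤ) : ℝ) * y) := by
      push_cast; ring
    refine ⟨(cosMonomial_of_mem h1 h2).congr fun _ _ _ _ _ _ => ?_,
      ((sinMonomial_of_mem h1 h2).smul (-1)).congr fun _ _ _ _ _ _ => ?_⟩
    · rw [cosMonomial, cosMonomial, e, Real.cos_neg]
    · simp only [sinMonomial, e, Real.sin_neg, Pi.smul_apply, smul_eq_mul]
      ring

/-- Components are spanned by monomials, so linear properties need checking only there. -/
theorem induction {P : ActionAngleFun → Prop} (h0 : P 0) (hadd : ∀ f g, P f → P g → P (f + g))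
    (hsmul : ∀ (r : ℝ) f, P f → P (r • f))
    (hcos : ∀ (a m : ℕ) (p q : ℤ), a + m = k → IsDAlembertIndex a m p q → P (cosMonomial a m p q))
    (hsin : ∀ (a m : ℕ) (p q : ℤ), a + m = k → IsDAlembertIndex a m p q → P (sinMonomial a m p q))
    (C S : ℕ → ℕ → ℤ → ℝ) : P (_root_.dAlembertComp k C S) := by
  rw [dAlembertComp_eq_sum]
  refine Finset.sum_induction _ P hadd h0 fun m hm => Finset.sum_induction _ P hadd h0
    fun p hp => Finset.sum_induction _ P hadd h0 fun q hq => ?_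
  have hm' : k - m + m = k := by have := Finset.mem_range.1 hm; omega
  have hi := isDAlembertIndex_of_mem hp hq
  exact hadd _ _ (hsmul _ _ (hcos _ _ _ _ hm' hi)) (hsmul _ _ (hsin _ _ _ _ hm' hi))

theorem _root_.IsDAlembertIndex.add {a m a' m' : ℕ} {p q p' q' : ℤ}
    (h : IsDAlembertIndex a m p q) (h' : IsDAlembertIndex a' m' p' q') :
    IsDAlembertIndex (a + a') (m + m') (p + p') (q + q') := by
  simp only [IsDAlembertIndex, abs_le] at *
  omega

theorem _root_.IsDAlembertIndex.sub {a m a' m' : ℕ} {p q p' q' : ℤ}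
    (h : IsDAlembertIndex a m p q) (h' : IsDAlembertIndex a' m' p' q') :
    IsDAlembertIndex (a + a') (m + m') (p - p') (q - q') := by
  simp only [IsDAlembertIndex, abs_le] at *
  omega

/-- The product-to-sum formulas turn a product of two monomials into monomials with the sum and the
difference of the indices, and both operations respect bounds and parities. -/
theorem mul (hf : IsDAlembertComp k f) (hg : IsDAlembertComp l g) :
    IsDAlembertComp (k + l) (f * g) := by
  obtain ⟨C, S, h⟩ := hf
  obtain ⟨C', S', h'⟩ := hg
  suffices hs : IsDAlembertComp (k + l)
      (_root_.dAlembertComp k C S * _root_.dAlembertComp l C' S') from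
    hs.congr fun I₁ I₂ φ₁ φ₂ h₁ h₂ =>
      congrArg₂ (· * ·) (h _ _ _ _ h₁ h₂) (h' _ _ _ _ h₁ h₂)
  have add_arg (p q p' q' : ℤ) (x y : ℝ) : ((p + p' : ℤ) : ℝ) * x + ((q + q' : ℤ) : ℝ) * y
      = (p * x + q * y) + (p' * x + q' * y) := by push_cast; ring
  have sub_arg (p q p' q' : ℤ) (x y : ℝ) : ((p - p' : ℤ) : ℝ) * x + ((q - q' : ℤ) : ℝ) * y
      = (p * x + q * y) - (p' * x + q' * y) := by push_cast; ring
  have hdeg {a m a' m' : ℕ} (h1 : a + m = k) (h2 : a' + m' = l) :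
      a + a' + (m + m') = k + l := by omega
  refine induction (k := k) (P := fun f => IsDAlembertComp (k + l)
    (f * _root_.dAlembertComp l C' S')) ?_ ?_ ?_ ?_ ?_ C S
  · rw [zero_mul]; exact zero _
  · intro f g hf hg
    rw [add_mul]; exact hf.add hg
  · intro r f hf
    rw [smul_mul_assoc]; exact hf.smul r
  -- Expanding the second factor as well leaves the products cos·cos, cos·sin, sin·cos and sin·sin.
  all_goals
    intro a m p q hk hi
    refine induction (k := l) (P := fun f => IsDAlembertComp (k + l) (_ * f)) ?_ ?_ ?_ ?_ ?_ C' S'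
    · rw [mul_zero]; exact zero _
    · intro f g hf hg
      rw [mul_add]; exact hf.add hg
    · intro r f hf
      rw [mul_smul_comm]; exact hf.smul r
  · intro a' m' p' q' hl hi'
    refine ((hdeg hk hl ▸ (monomial (hi.add hi')).1).add
      (hdeg hk hl ▸ (monomial (hi.sub hi')).1)).smul (1 / 2) |>.congr fun _ _ _ _ _ _ => ?_
    simp only [cosMonomial, Pi.mul_apply, Pi.add_apply, Pi.smul_apply, smul_eq_mul, add_arg,
      sub_arg, Real.cos_add, Real.cos_sub, pow_add]
    ring
  · intro a' m' p' q' hl hi'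
    refine ((hdeg hk hl ▸ (monomial (hi.add hi')).2).add
      ((hdeg hk hl ▸ (monomial (hi.sub hi')).2).smul (-1))).smul (1 / 2)
      |>.congr fun _ _ _ _ _ _ => ?_
    simp only [cosMonomial, sinMonomial, Pi.mul_apply, Pi.add_apply, Pi.smul_apply, smul_eq_mul,
      add_arg, sub_arg, Real.sin_add, Real.sin_sub, pow_add]
    ring
  · intro a' m' p' q' hl hi'
    refine ((hdeg hk hl ▸ (monomial (hi.add hi')).2).add
      (hdeg hk hl ▸ (monomial (hi.sub hi')).2)).smul (1 / 2) |>.congr fun _ _ _ _ _ _ => ?_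
    simp only [cosMonomial, sinMonomial, Pi.mul_apply, Pi.add_apply, Pi.smul_apply, smul_eq_mul,
      add_arg, sub_arg, Real.sin_add, Real.sin_sub, pow_add]
    ring
  · intro a' m' p' q' hl hi'
    refine (((hdeg hk hl ▸ (monomial (hi.add hi')).1).smul (-1)).add
      (hdeg hk hl ▸ (monomial (hi.sub hi')).1)).smul (1 / 2) |>.congr fun _ _ _ _ _ _ => ?_
    simp only [cosMonomial, sinMonomial, Pi.mul_apply, Pi.add_apply, Pi.smul_apply, smul_eq_mul,
      add_arg, sub_arg, Real.cos_add, Real.cos_sub, pow_add]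
    ring

end IsDAlembertComp

end DAlembert

/-! ### The operator `D` and multipliers in `-D²`. -/

namespace PRModel

variable {M : PRModel}

/-- The frequency `ω₁ p - ω₂ q` of `cos (p φ₁ + q φ₂)` under `D`. -/
noncomputable def freq (M : PRModel) (p : ℕ) (q : ℤ) : ℝ := M.ω₁ * p - M.ω₂ * q

/-- `f` is differentiable in the angles at the given point and `D f = d` there. -/
def HasD (M : PRModel) (f : ActionAngleFun) (d I₁ I₂ φ₁ φ₂ : ℝ) : Prop :=
  ∃ a b : ℝ, HasDerivAt (fun t => f I₁ I₂ t φ₂) a φ₁ ∧ HasDerivAt (fun t => f I₁ I₂ φ₁ t) b φ₂ ∧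
    d = M.ω₁ * a - M.ω₂ * b

namespace HasD

variable {f g : ActionAngleFun} {c d I₁ I₂ φ₁ φ₂ : ℝ}

/-- `D` is built from `deriv`, whose sum and product rules need differentiability. `HasD` carries
that information through a computation, and this is the way back to `D`. -/
theorem D_eq (h : M.HasD f d I₁ I₂ φ₁ φ₂) : M.D f I₁ I₂ φ₁ φ₂ = d := by
  obtain ⟨a, b, ha, hb, rfl⟩ := h
  rw [D, ha.deriv, hb.deriv]

theorem add (hf : M.HasD f c I₁ I₂ φ₁ φ₂) (hg : M.HasD g d I₁ I₂ φ₁ φ₂) :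
    M.HasD (fun I₁ I₂ φ₁ φ₂ => f I₁ I₂ φ₁ φ₂ + g I₁ I₂ φ₁ φ₂) (c + d) I₁ I₂ φ₁ φ₂ := by
  obtain ⟨a, b, ha, hb, rfl⟩ := hf
  obtain ⟨a', b', ha', hb', rfl⟩ := hg
  exact ⟨_, _, ha.add ha', hb.add hb', by ring⟩

theorem const_mul (hf : M.HasD f c I₁ I₂ φ₁ φ₂) (r : ℝ) :
    M.HasD (fun I₁ I₂ φ₁ φ₂ => r * f I₁ I₂ φ₁ φ₂) (r * c) I₁ I₂ φ₁ φ₂ := by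
  obtain ⟨a, b, ha, hb, rfl⟩ := hf
  exact ⟨_, _, ha.const_mul r, hb.const_mul r, by ring⟩

theorem mul (hf : M.HasD f c I₁ I₂ φ₁ φ₂) (hg : M.HasD g d I₁ I₂ φ₁ φ₂) :
    M.HasD (fun I₁ I₂ φ₁ φ₂ => f I₁ I₂ φ₁ φ₂ * g I₁ I₂ φ₁ φ₂)
      (c * g I₁ I₂ φ₁ φ₂ + f I₁ I₂ φ₁ φ₂ * d) I₁ I₂ φ₁ φ₂ := by
  obtain ⟨a, b, ha, hb, rfl⟩ := hf
  obtain ⟨a', b', ha', hb', rfl⟩ := hg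
  exact ⟨_, _, ha.mul ha', hb.mul hb', by ring⟩

end HasD

theorem hasD_dAlembertComp (M : PRModel) (k : ℕ) (C S : ℕ → ℕ → ℤ → ℝ) (I₁ I₂ φ₁ φ₂ : ℝ) :
    M.HasD (dAlembertComp k C S)
      (dAlembertComp k (fun m p q => M.freq p q * S m p q)
        (fun m p q => -(M.freq p q * C m p q)) I₁ I₂ φ₁ φ₂) I₁ I₂ φ₁ φ₂ := by
  refine ⟨_, _, hasDerivAt_dAlembertComp_fst k C S I₁ I₂ φ₁ φ₂,
    hasDerivAt_dAlembertComp_snd k C S I₁ I₂ φ₁ φ₂, ?_⟩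
  have e : dAlembertComp k (fun m p q => M.freq p q * S m p q)
        (fun m p q => -(M.freq p q * C m p q))
      = M.ω₁ • dAlembertComp k (fun m p q => p * S m p q) (fun m p q => -(p * C m p q))
        + (-M.ω₂) • dAlembertComp k (fun m p q => q * S m p q)
          (fun m p q => -(q * C m p q)) := by
    rw [dAlembertComp_smul, dAlembertComp_smul, dAlembertComp_add]
    congr 1
    all_goals
      funext m p q
      simp [freq]
      ring
  rw [e]
  simp only [Pi.add_apply, Pi.smul_apply, smul_eq_mul]
  ring

theorem D_dAlembertComp (M : PRModel) (k : ℕ) (C S : ℕ → ℕ → ℤ → ℝ) :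
    M.D (dAlembertComp k C S) = dAlembertComp k (fun m p q => M.freq p q * S m p q)
      (fun m p q => -(M.freq p q * C m p q)) := by
  funext I₁ I₂ φ₁ φ₂
  exact (hasD_dAlembertComp M k C S I₁ I₂ φ₁ φ₂).D_eq

theorem D_zero (M : PRModel) : M.D 0 = 0 := by
  funext I₁ I₂ φ₁ φ₂
  simp [D]

/-- The operator `-D²` multiplies both coefficients of a harmonic by `freq²`, so the modified
component is `Q(-D²)` applied to zero. No uniqueness of coefficients is involved. -/
theorem dAlembertComp_polynomial_eq_zero {k : ℕ} {C S : ℕ → ℕ → ℤ → ℝ}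
    (h : dAlembertComp k C S = 0) (Q : Polynomial ℝ) :
    dAlembertComp k (fun m p q => Q.eval (M.freq p q ^ 2) * C m p q)
      (fun m p q => Q.eval (M.freq p q ^ 2) * S m p q) = 0 := by
  induction Q using Polynomial.induction_on with
  | C a =>
    simp only [Polynomial.eval_C]
    have := dAlembertComp_smul k C S a
    rw [h, smul_zero] at this
    exact this.symm
  | add P Q hP hQ =>
    have := dAlembertComp_add k _ _ _ _ ▸ congrArg₂ (· + ·) hP hQ
    rw [add_zero] at this
    rw [← this]
    congr 1
    all_goals
      funext m p q
      simp [add_mul]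
  | monomial j a ih =>
    have h2 : M.D (M.D (0 : ActionAngleFun)) = 0 := by rw [D_zero, D_zero]
    rw [← ih, D_dAlembertComp, D_dAlembertComp, ih] at h2
    have := dAlembertComp_smul k _ _ (-1) ▸ congrArg ((-1 : ℝ) • ·) h2
    rw [smul_zero] at this
    rw [← this]
    congr 1
    all_goals
      funext m p q
      simp
      ring

/-- A multiplier in `-D²` without zeros on the spectrum is injective on homogeneous components. -/
theorem dAlembertComp_eq_zero_of_multiplier {k : ℕ} {C S : ℕ → ℕ → ℤ → ℝ} (σ : ℝ → ℝ)
    (hσ : ∀ m ∈ Finset.range (k + 1), ∀ p ∈ dAlembertP (k - m), ∀ q ∈ dAlembertQ m,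
      σ (M.freq p q ^ 2) ≠ 0)
    (h : dAlembertComp k (fun m p q => σ (M.freq p q ^ 2) * C m p q)
      (fun m p q => σ (M.freq p q ^ 2) * S m p q) = 0) :
    dAlembertComp k C S = 0 := by
  classical
  -- The spectrum of `-D²` in degree `k` is finite; interpolating `1/σ` on it gives a polynomial
  -- that undoes the multiplier.
  let s : Finset ℝ := (Finset.range (k + 1)).biUnion fun m => (dAlembertP (k - m)).biUnion
    fun p => (dAlembertQ m).image fun q => M.freq p q ^ 2
  have hP := dAlembertComp_polynomial_eq_zero (M := M) h
    (Lagrange.interpolate s id fun z => (σ z)⁻¹)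
  rw [← hP]
  refine dAlembertComp_congr fun m hm p hp q hq => ?_
  have hs : M.freq p q ^ 2 ∈ s := by
    simp only [s, Finset.mem_biUnion, Finset.mem_image]
    exact ⟨m, hm, p, hp, q, hq, rfl⟩
  have he : Polynomial.eval (M.freq p q ^ 2) (Lagrange.interpolate s id fun z => (σ z)⁻¹)
      = (σ (M.freq p q ^ 2))⁻¹ :=
    Lagrange.eval_interpolate_at_node (v := id) _ (Set.injOn_id _) hs
  rw [he, inv_mul_cancel_left₀ (hσ m hm p hp q hq), inv_mul_cancel_left₀ (hσ m hm p hp q hq)]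
  exact ⟨rfl, rfl⟩

end PRModel

/-! ### The potential, the drag one-form and their derivatives. -/

theorem analyticAt_quadratic_curve {f : ℝ × ℝ → ℝ} {a b : ℝ} (hf : ContDiffAt ℝ ω f (a, b))
    (x y x' y' : ℝ) :
    AnalyticAt ℝ (fun s : ℝ => f (a + (s * x + s ^ 2 * x'), b + (s * y + s ^ 2 * y'))) 0 := by
  have h : ContDiffAt ℝ ω
      (fun s : ℝ => (a + (s * x + s ^ 2 * x'), b + (s * y + s ^ 2 * y'))) 0 := by fun_prop
  have hf' : ContDiffAt ℝ ω f
      ((fun s : ℝ => (a + (s * x + s ^ 2 * x'), b + (s * y + s ^ 2 * y'))) 0) := by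
    simpa using hf
  exact (hf'.comp (0 : ℝ) h).analyticAt

/-- The quartic is the kinetic energy along velocities `s u + s² u'`; only its middle coefficient
reaches order three. -/
theorem iteratedDeriv_three_quartic_sub {f : ℝ → ℝ} (hf : AnalyticAt ℝ f 0) (c d e : ℝ) :
    iteratedDeriv 3 (fun s : ℝ => c * s ^ 2 + d * s ^ 3 + e * s ^ 4 - f s) 0
      = 6 * d - iteratedDeriv 3 f 0 := by
  have f0 := hf.eventually_hasDerivAt
  have f1 := hf.deriv.eventually_hasDerivAt
  have f2 := hf.deriv.deriv.eventually_hasDerivAt.self_of_nhds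
  rw [iteratedDeriv_three_of_hasDerivAt f0 f1 f2]
  -- This is used for `j = 2, 1, 0`; at `j = 0` the truncated exponent `j - 1` is harmless, since
  -- its term carries the factor `j`.
  have hp (c d e : ℝ) (j : ℕ) (s : ℝ) : HasDerivAt
      (fun s : ℝ => c * s ^ j + d * s ^ (j + 1) + e * s ^ (j + 2))
      (c * (j * s ^ (j - 1)) + d * ((j + 1) * s ^ j) + e * ((j + 2) * s ^ (j + 1))) s := by
    refine ((((hasDerivAt_pow j s).const_mul c).add ((hasDerivAt_pow (j + 1) s).const_mul d)).add
      ((hasDerivAt_pow (j + 2) s).const_mul e)).congr_deriv ?_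
    simp
  refine iteratedDeriv_three_of_hasDerivAt
    (g := fun s => 2 * c * s ^ 1 + 3 * d * s ^ (1 + 1) + 4 * e * s ^ (1 + 2) - deriv f s)
    (h := fun s => 2 * c * s ^ 0 + 6 * d * s ^ (0 + 1) + 12 * e * s ^ (0 + 2)
      - deriv (deriv f) s) ?_ ?_ ?_
  · filter_upwards [f0] with s hs
    refine ((hp c d e 2 s).sub hs).congr_deriv ?_
    norm_num
    ring
  · filter_upwards [f1] with s hs
    refine ((hp (2 * c) (3 * d) (4 * e) 1 s).sub hs).congr_deriv ?_
    norm_num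
    ring
  · refine ((hp (2 * c) (6 * d) (12 * e) 0 0).sub f2).congr_deriv ?_
    norm_num

/-- One formula serves both distances and both variables through the choice of `e` and `d`. For a
negative radicand the function is locally zero and the right-hand side is zero by the conventions
for `√` and `⁻¹`. -/
theorem hasDerivAt_inv_sqrt_add_sq {e d x : ℝ} (h : (x + e) ^ 2 + d ≠ 0) :
    HasDerivAt (fun t => (√((t + e) ^ 2 + d))⁻¹) (-((x + e) * (√((x + e) ^ 2 + d))⁻¹ ^ 3)) x := by
  by_cases hn : 0 < (x + e) ^ 2 + d
  · have hr : √((x + e) ^ 2 + d) ≠ 0 := (Real.sqrt_pos.2 hn).ne'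
    have h1 : HasDerivAt (fun t : ℝ => (t + e) ^ 2 + d) (2 * (x + e)) x := by
      simpa using (((hasDerivAt_id x).add_const e).pow 2).add_const d
    refine ((h1.sqrt h).inv hr).congr_deriv ?_
    field_simp
  · have hlt : (x + e) ^ 2 + d < 0 := lt_of_le_of_ne (not_lt.1 hn) h
    have hc : Continuous (fun t : ℝ => (t + e) ^ 2 + d) := by fun_prop
    have hev : (fun t : ℝ => (√((t + e) ^ 2 + d))⁻¹) =ᶠ[𝓝 x] fun _ => 0 := by
      filter_upwards [hc.tendsto x |>.eventually_lt_const hlt] with t ht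
      rw [Real.sqrt_eq_zero_of_nonpos ht.le, inv_zero]
    rw [Real.sqrt_eq_zero_of_nonpos hlt.le]
    simpa using (hasDerivAt_const x (0 : ℝ)).congr_of_eventuallyEq hev

namespace PRModel

variable {M : PRModel}

/-- The potential part of the Lagrangian. -/
noncomputable def V (M : PRModel) (z : ℝ × ℝ) : ℝ := M.L z.1 z.2 0 0

/-- The components of the part of the drag term of the Lagrangian which is linear in the
velocities. -/
noncomputable def dragX (M : PRModel) (z : ℝ × ℝ) : ℝ :=
  M.W₁ / 2 * ((z.1 + M.μ) * (M.r₁ z.1 z.2 ^ 2)⁻¹)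

noncomputable def dragY (M : PRModel) (z : ℝ × ℝ) : ℝ :=
  M.W₁ / 2 * (z.2 * (M.r₁ z.1 z.2 ^ 2)⁻¹)

theorem L_eq (M : PRModel) (x y u v : ℝ) :
    M.L x y u v = M.V (x, y) + ((u ^ 2 + v ^ 2) / 2 + M.n * (x * v - u * y))
      + (M.dragX (x, y) * u + M.dragY (x, y) * v) := by
  simp only [L, V, dragX, dragY]
  ring

/-- By Euler's identity, `p·v - L` keeps the terms quadratic in the velocities, cancels the linear
ones and changes the sign of the others. Both the gyroscopic and the drag one-form thus disappear.
-/
theorem H_eq (M : PRModel) (x y u v : ℝ) : M.H x y u v = (u ^ 2 + v ^ 2) / 2 - M.V (x, y) := by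
  have hp (c d e f : ℝ) (w : ℝ) : HasDerivAt (fun t : ℝ => c + ((t ^ 2 + d) / 2 + e * t) + f * t)
      (w + e + f) w := by
    have h := (((((hasDerivAt_pow 2 w).add_const d).div_const 2).add
      ((hasDerivAt_id' w).const_mul e)).const_add c).add ((hasDerivAt_id' w).const_mul f)
    refine h.congr_deriv ?_
    simp
  have hx : M.px x y u v = u + -(M.n * y) + M.dragX (x, y) := by
    have e : (fun t => M.L x y t v) = fun t => (M.V (x, y) + M.n * (x * v) + M.dragY (x, y) * v)
        + ((t ^ 2 + v ^ 2) / 2 + -(M.n * y) * t) + M.dragX (x, y) * t := by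
      funext t
      rw [L_eq]; ring
    rw [px, e, (hp _ _ _ _ u).deriv]
  have hy : M.py x y u v = v + M.n * x + M.dragY (x, y) := by
    have e : (fun t => M.L x y u t) = fun t => (M.V (x, y) - M.n * (u * y) + M.dragX (x, y) * u)
        + ((t ^ 2 + u ^ 2) / 2 + (M.n * x) * t) + M.dragY (x, y) * t := by
      funext t
      rw [L_eq]; ring
    rw [py, e, (hp _ _ _ _ v).deriv]
  rw [H, hx, hy, L_eq]
  ring

section Regular

variable {x y : ℝ}

theorem r₁_ne_zero (hy : y ≠ 0) : M.r₁ x y ≠ 0 :=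
  (Real.sqrt_pos.2 (by positivity)).ne'

theorem r₂_ne_zero (hy : y ≠ 0) : M.r₂ x y ≠ 0 :=
  (Real.sqrt_pos.2 (by positivity)).ne'

theorem contDiffAt_r₁ (hy : y ≠ 0) : ContDiffAt ℝ ω (fun z : ℝ × ℝ => M.r₁ z.1 z.2) (x, y) := by
  unfold r₁
  refine ContDiffAt.sqrt (by fun_prop) ?_
  have : 0 < (x + M.μ) ^ 2 + y ^ 2 := by positivity
  exact this.ne'

theorem contDiffAt_r₂ (hy : y ≠ 0) : ContDiffAt ℝ ω (fun z : ℝ × ℝ => M.r₂ z.1 z.2) (x, y) := by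
  unfold r₂
  refine ContDiffAt.sqrt (by fun_prop) ?_
  have : 0 < (x + M.μ - 1) ^ 2 + y ^ 2 := by positivity
  exact this.ne'

theorem contDiffAt_dragX (hy : y ≠ 0) : ContDiffAt ℝ ω M.dragX (x, y) := by
  unfold dragX
  refine contDiffAt_const.mul (ContDiffAt.mul (by fun_prop) (((contDiffAt_r₁ hy).pow 2).inv ?_))
  exact pow_ne_zero 2 (r₁_ne_zero hy)

theorem contDiffAt_dragY (hy : y ≠ 0) : ContDiffAt ℝ ω M.dragY (x, y) := by
  unfold dragY
  refine contDiffAt_const.mul (ContDiffAt.mul (by fun_prop) (((contDiffAt_r₁ hy).pow 2).inv ?_))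
  exact pow_ne_zero 2 (r₁_ne_zero hy)

theorem V_eq (M : PRModel) (x y : ℝ) :
    M.V (x, y) = M.n ^ 2 / 2 * (x ^ 2 + y ^ 2) + (1 - M.μ) * M.q₁ * (M.r₁ x y)⁻¹
      + M.μ * (M.r₂ x y)⁻¹ + M.μ * M.A₂ / 2 * (M.r₂ x y)⁻¹ ^ 3
      - M.W₁ * M.n * Real.arctan (y / (x + M.μ)) := by
  simp only [V, L]
  ring

theorem contDiffAt_V (hy : y ≠ 0) (hx : x + M.μ ≠ 0) : ContDiffAt ℝ ω M.V (x, y) := by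
  have h1 := (contDiffAt_r₁ (M := M) (x := x) hy).inv (r₁_ne_zero hy)
  have h2 := (contDiffAt_r₂ (M := M) (x := x) hy).inv (r₂_ne_zero hy)
  have hq : ContDiffAt ℝ ω (fun z : ℝ × ℝ => z.2 / (z.1 + M.μ)) (x, y) :=
    ContDiffAt.div (by fun_prop) (by fun_prop) hx
  have h3 : ContDiffAt ℝ ω (fun z : ℝ × ℝ => Real.arctan (z.2 / (z.1 + M.μ))) (x, y) :=
    Real.contDiff_arctan.contDiffAt.comp _ hq
  have h0 : ContDiffAt ℝ ω (fun z : ℝ × ℝ => M.n ^ 2 / 2 * (z.1 ^ 2 + z.2 ^ 2)) (x, y) := by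
    fun_prop
  have h := (((h0.add (contDiffAt_const (c := (1 - M.μ) * M.q₁) |>.mul h1)).add (contDiffAt_const (c := M.μ) |>.mul h2)).add
    (contDiffAt_const (c := M.μ * M.A₂ / 2) |>.mul (h2.pow 3))).sub (contDiffAt_const (c := M.W₁ * M.n) |>.mul h3)
  exact h.congr_of_eventuallyEq (Eventually.of_forall fun z => V_eq M z.1 z.2)

theorem hasDerivAt_inv_r₁_fst (hy : y ≠ 0) :
    HasDerivAt (fun t => (M.r₁ t y)⁻¹) (-((x + M.μ) * (M.r₁ x y)⁻¹ ^ 3)) x :=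
  hasDerivAt_inv_sqrt_add_sq (by positivity)

theorem hasDerivAt_inv_r₁_snd (hy : y ≠ 0) :
    HasDerivAt (fun t => (M.r₁ x t)⁻¹) (-(y * (M.r₁ x y)⁻¹ ^ 3)) y := by
  have h := hasDerivAt_inv_sqrt_add_sq (e := 0) (d := (x + M.μ) ^ 2) (x := y)
    (by rw [add_zero]; positivity)
  simpa [r₁, add_comm] using h

theorem hasDerivAt_inv_r₂_fst (hy : y ≠ 0) :
    HasDerivAt (fun t => (M.r₂ t y)⁻¹) (-((x + M.μ - 1) * (M.r₂ x y)⁻¹ ^ 3)) x := by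
  have h := hasDerivAt_inv_sqrt_add_sq (e := M.μ - 1) (d := y ^ 2) (x := x) (by positivity)
  simpa only [r₂, add_sub_assoc] using h

theorem hasDerivAt_inv_r₂_snd (hy : y ≠ 0) :
    HasDerivAt (fun t => (M.r₂ x t)⁻¹) (-(y * (M.r₂ x y)⁻¹ ^ 3)) y := by
  have h := hasDerivAt_inv_sqrt_add_sq (e := 0) (d := (x + M.μ - 1) ^ 2) (x := y)
    (by rw [add_zero]; positivity)
  simpa [r₂, add_comm] using h

theorem inv_r₁_sq (M : PRModel) (x y : ℝ) :
    (M.r₁ x y)⁻¹ ^ 2 = ((x + M.μ) ^ 2 + y ^ 2)⁻¹ := by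
  rw [r₁, inv_pow, Real.sq_sqrt (by positivity)]

theorem inv_r₂_sq (M : PRModel) (x y : ℝ) :
    (M.r₂ x y)⁻¹ ^ 2 = ((x + M.μ - 1) ^ 2 + y ^ 2)⁻¹ := by
  rw [r₂, inv_pow, Real.sq_sqrt (by positivity)]

/-- The one-form of the drag term is closed. -/
theorem partialY_dragX_eq (hy : y ≠ 0) : partialY M.dragX (x, y) = partialX M.dragY (x, y) := by
  have h1 : HasDerivAt (fun t => M.dragX (x, t))
      (M.W₁ / 2 * ((x + M.μ) * (2 * (M.r₁ x y)⁻¹ * -(y * (M.r₁ x y)⁻¹ ^ 3)))) y := by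
    have h := (((hasDerivAt_inv_r₁_snd (M := M) (x := x) hy).pow 2).const_mul
      (x + M.μ)).const_mul (M.W₁ / 2)
    simpa [dragX, inv_pow] using h
  have h2 : HasDerivAt (fun t => M.dragY (t, y))
      (M.W₁ / 2 * (y * (2 * (M.r₁ x y)⁻¹ * -((x + M.μ) * (M.r₁ x y)⁻¹ ^ 3)))) x := by
    have h := (((hasDerivAt_inv_r₁_fst (M := M) (x := x) hy).pow 2).const_mul
      y).const_mul (M.W₁ / 2)
    simpa [dragY, inv_pow] using h
  rw [h1.partialY_eq ((contDiffAt_dragX hy).differentiableAt (by simp)),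
    h2.partialX_eq ((contDiffAt_dragY hy).differentiableAt (by simp))]
  ring

theorem hasDerivAt_V_fst (hy : y ≠ 0) (hx : x + M.μ ≠ 0) :
    HasDerivAt (fun t => M.V (t, y))
      (M.n ^ 2 * x - (1 - M.μ) * M.q₁ * ((x + M.μ) * (M.r₁ x y)⁻¹ ^ 3)
        - M.μ * ((x + M.μ - 1) * (M.r₂ x y)⁻¹ ^ 3)
        - 3 / 2 * (M.μ * M.A₂) * ((x + M.μ - 1) * (M.r₂ x y)⁻¹ ^ 5)
        + M.W₁ * M.n * (y * (M.r₁ x y)⁻¹ ^ 2)) x := by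
  have h0 : HasDerivAt (fun t : ℝ => M.n ^ 2 / 2 * (t ^ 2 + y ^ 2)) (M.n ^ 2 * x) x := by
    refine (((hasDerivAt_pow 2 x).add_const (y ^ 2)).const_mul (M.n ^ 2 / 2)).congr_deriv ?_
    simp; ring
  have h1 := hasDerivAt_inv_r₁_fst (M := M) (x := x) hy
  have h2 := hasDerivAt_inv_r₂_fst (M := M) (x := x) hy
  have h3 : HasDerivAt (fun t : ℝ => Real.arctan (y / (t + M.μ)))
      (-(y * (M.r₁ x y)⁻¹ ^ 2)) x := by
    refine (((hasDerivAt_const x y).div ((hasDerivAt_id' x).add_const M.μ) hx).arctan).congr_deriv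
      ?_
    rw [inv_r₁_sq]
    have : 0 < (x + M.μ) ^ 2 + y ^ 2 := by positivity
    simp only [Pi.div_apply]
    field_simp
    ring
  have h := (((h0.add (h1.const_mul ((1 - M.μ) * M.q₁))).add (h2.const_mul M.μ)).add
    ((h2.pow 3).const_mul (M.μ * M.A₂ / 2))).sub (h3.const_mul (M.W₁ * M.n))
  have h' := h.congr_of_eventuallyEq (f₁ := fun t => M.V (t, y))
    (Eventually.of_forall fun t => by simp [V_eq])
  refine h'.congr_deriv ?_
  simp; ring

theorem hasDerivAt_V_snd (hy : y ≠ 0) (hx : x + M.μ ≠ 0) :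
    HasDerivAt (fun t => M.V (x, t))
      (M.n ^ 2 * y - (1 - M.μ) * M.q₁ * (y * (M.r₁ x y)⁻¹ ^ 3)
        - M.μ * (y * (M.r₂ x y)⁻¹ ^ 3)
        - 3 / 2 * (M.μ * M.A₂) * (y * (M.r₂ x y)⁻¹ ^ 5)
        - M.W₁ * M.n * ((x + M.μ) * (M.r₁ x y)⁻¹ ^ 2)) y := by
  have h0 : HasDerivAt (fun t : ℝ => M.n ^ 2 / 2 * (x ^ 2 + t ^ 2)) (M.n ^ 2 * y) y := by
    refine (((hasDerivAt_pow 2 y).const_add (x ^ 2)).const_mul (M.n ^ 2 / 2)).congr_deriv ?_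
    simp; ring
  have h1 := hasDerivAt_inv_r₁_snd (M := M) (x := x) hy
  have h2 := hasDerivAt_inv_r₂_snd (M := M) (x := x) hy
  have h3 : HasDerivAt (fun t : ℝ => Real.arctan (t / (x + M.μ)))
      ((x + M.μ) * (M.r₁ x y)⁻¹ ^ 2) y := by
    refine (((hasDerivAt_id' y).div_const (x + M.μ)).arctan).congr_deriv ?_
    rw [inv_r₁_sq]
    have : 0 < (x + M.μ) ^ 2 + y ^ 2 := by positivity
    field_simp
  have h := (((h0.add (h1.const_mul ((1 - M.μ) * M.q₁))).add (h2.const_mul M.μ)).add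
    ((h2.pow 3).const_mul (M.μ * M.A₂ / 2))).sub (h3.const_mul (M.W₁ * M.n))
  have h' := h.congr_of_eventuallyEq (f₁ := fun t => M.V (x, t))
    (Eventually.of_forall fun t => by simp [V_eq])
  refine h'.congr_deriv ?_
  simp; ring

theorem iteratedDeriv_two_V_fst (hy : y ≠ 0) (hx : x + M.μ ≠ 0) :
    iteratedDeriv 2 (fun s => M.V (x + s, y)) 0
      = M.n ^ 2 + (1 - M.μ) * M.q₁ * (3 * (x + M.μ) ^ 2 * (M.r₁ x y)⁻¹ ^ 5 - (M.r₁ x y)⁻¹ ^ 3)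
        + M.μ * (3 * (x + M.μ - 1) ^ 2 * (M.r₂ x y)⁻¹ ^ 5 - (M.r₂ x y)⁻¹ ^ 3)
        + 3 / 2 * (M.μ * M.A₂)
          * (5 * (x + M.μ - 1) ^ 2 * (M.r₂ x y)⁻¹ ^ 7 - (M.r₂ x y)⁻¹ ^ 5)
        - 2 * M.W₁ * M.n * (y * (x + M.μ) * (M.r₁ x y)⁻¹ ^ 4) := by
  have hev : ∀ᶠ s in 𝓝 (0 : ℝ), x + s + M.μ ≠ 0 := by
    have hc : Continuous fun s : ℝ => x + s + M.μ := by fun_prop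
    exact hc.continuousAt.eventually_ne (by simpa using hx)
  refine iteratedDeriv_two_of_hasDerivAt
    (hev.mono fun s hs => (hasDerivAt_V_fst hy hs).comp_const_add x s) ?_
  have h1 := hasDerivAt_inv_r₁_fst (M := M) (x := x) hy
  have h2 := hasDerivAt_inv_r₂_fst (M := M) (x := x) hy
  have hX := (hasDerivAt_id' x).add_const M.μ
  have hX' := hX.sub_const 1
  have h := (((((hasDerivAt_id' x).const_mul (M.n ^ 2)).sub
    ((hX.mul (h1.pow 3)).const_mul ((1 - M.μ) * M.q₁))).sub
    ((hX'.mul (h2.pow 3)).const_mul M.μ)).sub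
    ((hX'.mul (h2.pow 5)).const_mul (3 / 2 * (M.μ * M.A₂)))).add
    (((h1.pow 2).const_mul y).const_mul (M.W₁ * M.n))
  -- The base point is written as `x + 0` to fit the rule for translates.
  rw [← add_zero x] at h
  refine (h.comp_const_add x 0).congr_deriv ?_
  simp
  ring

theorem iteratedDeriv_two_V_snd (hy : y ≠ 0) (hx : x + M.μ ≠ 0) :
    iteratedDeriv 2 (fun s => M.V (x, y + s)) 0
      = M.n ^ 2 + (1 - M.μ) * M.q₁ * (3 * y ^ 2 * (M.r₁ x y)⁻¹ ^ 5 - (M.r₁ x y)⁻¹ ^ 3)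
        + M.μ * (3 * y ^ 2 * (M.r₂ x y)⁻¹ ^ 5 - (M.r₂ x y)⁻¹ ^ 3)
        + 3 / 2 * (M.μ * M.A₂) * (5 * y ^ 2 * (M.r₂ x y)⁻¹ ^ 7 - (M.r₂ x y)⁻¹ ^ 5)
        + 2 * M.W₁ * M.n * (y * (x + M.μ) * (M.r₁ x y)⁻¹ ^ 4) := by
  have hev : ∀ᶠ s in 𝓝 (0 : ℝ), y + s ≠ 0 := by
    have hc : Continuous fun s : ℝ => y + s := by fun_prop
    exact hc.continuousAt.eventually_ne (by simpa using hy)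
  refine iteratedDeriv_two_of_hasDerivAt
    (hev.mono fun s hs => (hasDerivAt_V_snd hs hx).comp_const_add y s) ?_
  have h1 := hasDerivAt_inv_r₁_snd (M := M) (x := x) hy
  have h2 := hasDerivAt_inv_r₂_snd (M := M) (x := x) hy
  have hY := hasDerivAt_id' y
  have h := ((((hY.const_mul (M.n ^ 2)).sub
    ((hY.mul (h1.pow 3)).const_mul ((1 - M.μ) * M.q₁))).sub
    ((hY.mul (h2.pow 3)).const_mul M.μ)).sub
    ((hY.mul (h2.pow 5)).const_mul (3 / 2 * (M.μ * M.A₂)))).sub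
    (((h1.pow 2).const_mul (x + M.μ)).const_mul (M.W₁ * M.n))
  rw [← add_zero y] at h
  refine (h.comp_const_add y 0).congr_deriv ?_
  simp
  ring

/-- The drag terms of the potential are harmonic, the other ones strictly subharmonic. -/
theorem laplacian_V_pos (hμ₀ : 0 < M.μ) (hμ : M.μ ≤ 1 / 2) (hq₀ : 0 < M.q₁) (hA : 0 ≤ M.A₂)
    (hy : y ≠ 0) (hx : x + M.μ ≠ 0) :
    0 < iteratedDeriv 2 (fun s => M.V (x + s, y)) 0
      + iteratedDeriv 2 (fun s => M.V (x, y + s)) 0 := by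
  rw [iteratedDeriv_two_V_fst hy hx, iteratedDeriv_two_V_snd hy hx]
  have e1 : ((x + M.μ) ^ 2 + y ^ 2) * (M.r₁ x y)⁻¹ ^ 2 = 1 := by
    rw [inv_r₁_sq]; exact mul_inv_cancel₀ (by positivity)
  have e2 : ((x + M.μ - 1) ^ 2 + y ^ 2) * (M.r₂ x y)⁻¹ ^ 2 = 1 := by
    rw [inv_r₂_sq]; exact mul_inv_cancel₀ (by positivity)
  have p1 : 0 < (M.r₁ x y)⁻¹ := inv_pos.2 (Real.sqrt_pos.2 (by positivity))
  have p2 : 0 < (M.r₂ x y)⁻¹ := inv_pos.2 (Real.sqrt_pos.2 (by positivity))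
  have hm : 0 < 1 - M.μ := by linarith
  -- In the plane the Laplacian of `r^(-k)` is `k² r^(-k-2)`, whence the factors `1` for `1/r` and
  -- `9` for `1/r³`; the two arctangent terms cancel.
  have hpos : 0 < 2 * M.n ^ 2 + (1 - M.μ) * M.q₁ * (M.r₁ x y)⁻¹ ^ 3 + M.μ * (M.r₂ x y)⁻¹ ^ 3
      + 9 / 2 * (M.μ * M.A₂) * (M.r₂ x y)⁻¹ ^ 5 := by positivity
  refine hpos.trans_eq ?_
  linear_combination (-3 * (1 - M.μ) * M.q₁ * (M.r₁ x y)⁻¹ ^ 3) * e1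
    - (3 * M.μ * (M.r₂ x y)⁻¹ ^ 3 + 15 / 2 * (M.μ * M.A₂) * (M.r₂ x y)⁻¹ ^ 5) * e2

end Regular

/-! ### Taylor coefficients at the equilibrium and the sign of `2F - n²`. -/

/-- Taylor coefficients of the Lagrangian and of the Hamiltonian at the equilibrium. -/
structure IsJet (M : PRModel) (c₃₀ c₂₁ c₁₂ c₀₃ d₀ d₁ d₂ d₃ : ℝ) : Prop where
  Lpart_three : ∀ x y u v : ℝ, M.Lpart 3 x y u v
    = c₃₀ * x ^ 3 + c₂₁ * (x ^ 2 * y) + c₁₂ * (x * y ^ 2) + c₀₃ * y ^ 3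
      + (d₀ * x ^ 2 + 2 * d₁ * (x * y) + d₂ * y ^ 2) * u
      + (d₁ * x ^ 2 + 2 * d₂ * (x * y) + d₃ * y ^ 2) * v
  H_three : ∀ x y u v x' y' u' v' : ℝ,
    iteratedDeriv 3 (fun s : ℝ => M.H (M.xs + (s * x + s ^ 2 * x')) (M.ys + (s * y + s ^ 2 * y'))
      (s * u + s ^ 2 * u') (s * v + s ^ 2 * v')) 0 / (Nat.factorial 3 : ℝ)
    = u * u' + v * v' - (c₃₀ * x ^ 3 + c₂₁ * (x ^ 2 * y) + c₁₂ * (x * y ^ 2) + c₀₃ * y ^ 3)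
      + (2 * M.E - M.n ^ 2) * (x * x') + M.G * (x * y' + y * x')
      + (2 * M.F - M.n ^ 2) * (y * y')

/-- Closedness of the drag one-form is what lets both velocity coefficients share `d₁` and `d₂`. The
kinetic and gyroscopic terms have degree at most two and leave no trace in `L₃`. -/
theorem exists_isJet (hy : M.ys ≠ 0) (hx : M.xs + M.μ ≠ 0) :
    ∃ c₃₀ c₂₁ c₁₂ c₀₃ d₀ d₁ d₂ d₃, M.IsJet c₃₀ c₂₁ c₁₂ c₀₃ d₀ d₁ d₂ d₃ := by
  have hV := contDiffAt_V hy hx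
  obtain ⟨c₂₀, c₁₁, c₀₂, c₃₀, c₂₁, c₁₂, c₀₃, h2, h3⟩ := exists_cubic_jet hV
  have hdX := contDiffAt_dragX (M := M) (x := M.xs) hy
  have hdY := contDiffAt_dragY (M := M) (x := M.xs) hy
  have hclosed : partialY M.dragX =ᶠ[𝓝 (M.xs, M.ys)] partialX M.dragY := by
    have : ∀ᶠ z : ℝ × ℝ in 𝓝 (M.xs, M.ys), z.2 ≠ 0 := continuousAt_snd.eventually_ne hy
    exact this.mono fun z hz => partialY_dragX_eq hz
  obtain ⟨d₀, d₁, d₂, d₃, hX, hY⟩ := exists_quadratic_jet_of_closed hdX hdY hclosed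
  have hL2 (x y : ℝ) : M.Lpart 2 x y 0 0 = c₂₀ * x ^ 2 + c₁₁ * (x * y) + c₀₂ * y ^ 2 := by
    have h := h2 x y
    simp only [V] at h
    simp only [Lpart, mul_zero, h]
    simp
  -- At zero velocity `L` is `V`, so `E`, `F`, `G` are read off from its quadratic jet.
  have hE : M.E = M.n ^ 2 / 2 - c₂₀ := by rw [E, hL2]; ring
  have hF : M.F = M.n ^ 2 / 2 - c₀₂ := by rw [F, hL2]; ring
  have hG : M.G = -c₁₁ := by rw [G, hL2, hE, hF]; ring
  refine ⟨c₃₀, c₂₁, c₁₂, c₀₃, d₀, d₁, d₂, d₃, fun x y u v => ?_,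
    fun x y u v x' y' u' v' => ?_⟩
  · have h := iteratedDeriv_three_add_mul (analyticAt_curve hV x y) (analyticAt_curve hdX x y)
      (analyticAt_curve hdY x y) (M.n * (M.xs * v - u * M.ys))
      ((u ^ 2 + v ^ 2) / 2 + M.n * (x * v - u * y)) u v
    have e : (fun s : ℝ => M.L (M.xs + s * x) (M.ys + s * y) (s * u) (s * v))
        = fun s => M.V (M.xs + s * x, M.ys + s * y) + (M.n * (M.xs * v - u * M.ys) * s
          + ((u ^ 2 + v ^ 2) / 2 + M.n * (x * v - u * y)) * s ^ 2)
          + s * (M.dragX (M.xs + s * x, M.ys + s * y) * u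
            + M.dragY (M.xs + s * x, M.ys + s * y) * v) := by
      funext s
      rw [L_eq]
      ring
    have h3' := h3 x y 0 0
    simp only [mul_zero, add_zero] at h3'
    rw [Lpart, e, h, h3', hX, hY]
    simp [Nat.factorial]
    ring
  · have e : (fun s : ℝ => M.H (M.xs + (s * x + s ^ 2 * x')) (M.ys + (s * y + s ^ 2 * y'))
        (s * u + s ^ 2 * u') (s * v + s ^ 2 * v'))
        = fun s => (u ^ 2 + v ^ 2) / 2 * s ^ 2 + (u * u' + v * v') * s ^ 3
          + (u' ^ 2 + v' ^ 2) / 2 * s ^ 4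
          - M.V (M.xs + (s * x + s ^ 2 * x'), M.ys + (s * y + s ^ 2 * y')) := by
      funext s
      rw [H_eq]
      ring
    rw [e, iteratedDeriv_three_quartic_sub (analyticAt_quadratic_curve hV x y x' y'), h3, hE, hF,
      hG]
    simp [Nat.factorial]
    ring

/-- `E + F < n²`, since the Laplacian of the potential is positive. -/
theorem E_add_F_lt (hμ₀ : 0 < M.μ) (hμ : M.μ ≤ 1 / 2) (hq₀ : 0 < M.q₁) (hA : 0 ≤ M.A₂)
    (hy : M.ys ≠ 0) (hx : M.xs + M.μ ≠ 0) : M.E + M.F < M.n ^ 2 := by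
  have h := laplacian_V_pos hμ₀ hμ hq₀ hA hy hx
  simp only [E, F, Lpart, mul_zero, mul_one, add_zero]
  simp only [V] at h
  norm_num [Nat.factorial]
  linarith

/-- On the imaginary axis the characteristic equation is a real quadratic equation in `ω²`, with the
two distinct roots `ω₁²` and `ω₂²`. -/
theorem frequencies_vieta (h : M.HasFrequencies) :
    M.ω₁ ^ 2 + M.ω₂ ^ 2 = 2 * (M.E + M.F + M.n ^ 2) ∧
      M.ω₁ ^ 2 * M.ω₂ ^ 2 = (2 * M.E - M.n ^ 2) * (2 * M.F - M.n ^ 2) - M.G ^ 2 := by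
  obtain ⟨h2, h12, hc1, hc2⟩ := h
  have key (w : ℝ) (hw : M.charEq (Complex.I * w) = 0) :
      w ^ 4 - 2 * (M.E + M.F + M.n ^ 2) * w ^ 2
        + (4 * M.E * M.F - M.G ^ 2 + M.n ^ 4 - 2 * M.n ^ 2 * (M.E + M.F)) = 0 := by
    have hI := Complex.I_sq
    have : ((w ^ 4 - 2 * (M.E + M.F + M.n ^ 2) * w ^ 2
        + (4 * M.E * M.F - M.G ^ 2 + M.n ^ 4 - 2 * M.n ^ 2 * (M.E + M.F)) : ℝ) : ℂ) = 0 := by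
      rw [← hw, charEq]
      push_cast
      linear_combination (-(w : ℂ) ^ 4 * (Complex.I ^ 2 - 1)
        - 2 * (M.E + M.F + M.n ^ 2) * (w : ℂ) ^ 2) * hI
    exact_mod_cast this
  have k1 := key _ hc1
  have k2 := key _ hc2
  have hne : M.ω₁ ^ 2 - M.ω₂ ^ 2 ≠ 0 := by
    have : 0 < M.ω₁ ^ 2 - M.ω₂ ^ 2 := by nlinarith
    exact this.ne'
  have hs : M.ω₁ ^ 2 + M.ω₂ ^ 2 = 2 * (M.E + M.F + M.n ^ 2) := by
    apply mul_left_cancel₀ hne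
    linear_combination k1 - k2
  refine ⟨hs, ?_⟩
  linear_combination M.ω₁ ^ 2 * hs - k1

/-- The numbers `2E - n²` and `2F - n²` have the positive product `ω₁²ω₂² + G²` and a negative sum,
so both are negative. This makes the radicands of `l₁` and `l₂` positive. -/
theorem two_F_lt (hfreq : M.HasFrequencies) (h : M.E + M.F < M.n ^ 2) :
    2 * M.F - M.n ^ 2 < 0 := by
  have h2 := (frequencies_vieta hfreq).2
  have hpos : 0 < M.ω₁ ^ 2 * M.ω₂ ^ 2 := by
    have := hfreq.1.trans hfreq.2.1
    have := hfreq.1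
    positivity
  by_contra hb
  have : (2 * M.E - M.n ^ 2) * (2 * M.F - M.n ^ 2) ≤ 0 :=
    mul_nonpos_of_nonpos_of_nonneg (by linarith) (not_lt.1 hb)
  nlinarith [sq_nonneg M.G]

end PRModel

/-! ### Compatibility of agreement with `D`. -/

theorem ActionAngleFun.Agree.symm {f g : ActionAngleFun} (h : f.Agree g) : g.Agree f :=
  fun _ _ _ _ h₁ h₂ => (h _ _ _ _ h₁ h₂).symm

theorem ActionAngleFun.Agree.trans {f g j : ActionAngleFun} (h : f.Agree g) (h' : g.Agree j) :
    f.Agree j :=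
  fun _ _ _ _ h₁ h₂ => (h _ _ _ _ h₁ h₂).trans (h' _ _ _ _ h₁ h₂)

/-- `D` differentiates in the angles only, at fixed actions. -/
theorem ActionAngleFun.Agree.D {f g : ActionAngleFun} (h : f.Agree g) (M : PRModel) :
    (M.D f).Agree (M.D g) := by
  intro I₁ I₂ φ₁ φ₂ h₁ h₂
  have e (φ₁ φ₂ : ℝ) : f I₁ I₂ φ₁ φ₂ = g I₁ I₂ φ₁ φ₂ := h _ _ _ _ h₁ h₂
  simp only [PRModel.D, e]

namespace IsDAlembertComp

variable {k : ℕ} {f : ActionAngleFun}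

theorem D (hf : IsDAlembertComp k f) (M : PRModel) : IsDAlembertComp k (M.D f) := by
  obtain ⟨C, S, h⟩ := hf
  have h' := h.D M
  rw [PRModel.D_dAlembertComp] at h'
  exact ⟨_, _, h'⟩

theorem hasD (hf : IsDAlembertComp k f) (M : PRModel) {I₁ I₂ : ℝ} (h₁ : 0 ≤ I₁) (h₂ : 0 ≤ I₂)
    (φ₁ φ₂ : ℝ) : M.HasD f (M.D f I₁ I₂ φ₁ φ₂) I₁ I₂ φ₁ φ₂ := by
  obtain ⟨C, S, h⟩ := hf
  have e (φ₁ φ₂ : ℝ) : f I₁ I₂ φ₁ φ₂ = _root_.dAlembertComp k C S I₁ I₂ φ₁ φ₂ :=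
    h _ _ _ _ h₁ h₂
  obtain ⟨a, b, ha, hb, -⟩ := PRModel.hasD_dAlembertComp M k C S I₁ I₂ φ₁ φ₂
  have : M.HasD f (M.ω₁ * a - M.ω₂ * b) I₁ I₂ φ₁ φ₂ :=
    ⟨a, b, by simpa only [e] using ha, by simpa only [e] using hb, rfl⟩
  rwa [this.D_eq]

end IsDAlembertComp

/-! ### The linear normal form. -/

namespace PRModel

variable {M : PRModel}

theorem hasD_cosMonomial (M : PRModel) (a m : ℕ) (p q : ℤ) (I₁ I₂ φ₁ φ₂ : ℝ) :
    M.HasD (cosMonomial a m p q) (-(M.ω₁ * p - M.ω₂ * q) * sinMonomial a m p q I₁ I₂ φ₁ φ₂)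
      I₁ I₂ φ₁ φ₂ := by
  have h1 : HasDerivAt (fun t : ℝ => (p : ℝ) * t + q * φ₂) p φ₁ := by
    simpa using ((hasDerivAt_id' φ₁).const_mul (p : ℝ)).add_const (q * φ₂)
  have h2 : HasDerivAt (fun t : ℝ => (p : ℝ) * φ₁ + q * t) q φ₂ := by
    simpa using ((hasDerivAt_id' φ₂).const_mul (q : ℝ)).const_add (p * φ₁)
  refine ⟨_, _, h1.cos.const_mul _, h2.cos.const_mul _, ?_⟩
  rw [sinMonomial]
  ring

theorem hasD_sinMonomial (M : PRModel) (a m : ℕ) (p q : ℤ) (I₁ I₂ φ₁ φ₂ : ℝ) :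
    M.HasD (sinMonomial a m p q) ((M.ω₁ * p - M.ω₂ * q) * cosMonomial a m p q I₁ I₂ φ₁ φ₂)
      I₁ I₂ φ₁ φ₂ := by
  have h1 : HasDerivAt (fun t : ℝ => (p : ℝ) * t + q * φ₂) p φ₁ := by
    simpa using ((hasDerivAt_id' φ₁).const_mul (p : ℝ)).add_const (q * φ₂)
  have h2 : HasDerivAt (fun t : ℝ => (p : ℝ) * φ₁ + q * t) q φ₂ := by
    simpa using ((hasDerivAt_id' φ₂).const_mul (q : ℝ)).const_add (p * φ₁)
  refine ⟨_, _, h1.sin.const_mul _, h2.sin.const_mul _, ?_⟩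
  rw [cosMonomial]
  ring

section LinearPart

/-- The entries of the normalizing matrix, up to the normalization factors `s₁, s₂` of the two
modes. -/
structure IsNormalization (M : PRModel) (s₁ s₂ : ℝ) : Prop where
  ω₁_pos : 0 < M.ω₁
  ω₂_pos : 0 < M.ω₂
  J₁₃_eq : M.J₁₃ = s₁ * (M.ω₁ ^ 2 - (2 * M.F - M.n ^ 2)) / M.ω₁
  J₁₄_eq : M.J₁₄ = s₂ * (M.ω₂ ^ 2 - (2 * M.F - M.n ^ 2)) / M.ω₂
  J₂₁_eq : M.J₂₁ = -(2 * M.n * M.ω₁ * s₁)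
  J₂₂_eq : M.J₂₂ = 2 * M.n * M.ω₂ * s₂
  J₂₃_eq : M.J₂₃ = M.G * s₁ / M.ω₁
  J₂₄_eq : M.J₂₄ = M.G * s₂ / M.ω₂
  norm₁ : s₁ ^ 2 * (M.ω₁ ^ 2 - (2 * M.F - M.n ^ 2)) * (M.ω₁ ^ 2 - M.ω₂ ^ 2) = 1
  norm₂ : s₂ ^ 2 * (M.ω₂ ^ 2 - (2 * M.F - M.n ^ 2)) * (M.ω₁ ^ 2 - M.ω₂ ^ 2) = 1
  sum_eq : 2 * M.E - M.n ^ 2 = M.ω₁ ^ 2 + M.ω₂ ^ 2 - (2 * M.F - M.n ^ 2) - 4 * M.n ^ 2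
  G_sq : M.G ^ 2 = -((M.ω₁ ^ 2 - (2 * M.F - M.n ^ 2)) * (M.ω₂ ^ 2 - (2 * M.F - M.n ^ 2)))
    - 4 * M.n ^ 2 * (2 * M.F - M.n ^ 2)

/-- With `s_j = 2/(l_j κ)`, the identity `l_j²/4 = ω_j² - (2F - n²)` removes all radicals from the
entries of `J`. The relations for `2E - n²` and `G²` are Vieta's formulas solved for these
quantities. -/
theorem exists_isNormalization (hfreq : M.HasFrequencies) (hb : 2 * M.F - M.n ^ 2 < 0) :
    ∃ s₁ s₂, M.IsNormalization s₁ s₂ := by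
  obtain ⟨hs, hp⟩ := frequencies_vieta hfreq
  obtain ⟨hω₂, hω, -, -⟩ := hfreq
  have hω₁ := hω₂.trans hω
  have p1 : 0 < 4 * (M.ω₁ ^ 2 + M.n ^ 2 - 2 * M.F) := by nlinarith [sq_pos_of_pos hω₁]
  have p2 : 0 < 4 * (M.ω₂ ^ 2 + M.n ^ 2 - 2 * M.F) := by nlinarith [sq_pos_of_pos hω₂]
  have p3 : 0 < M.ω₁ ^ 2 - M.ω₂ ^ 2 := by nlinarith
  have l1 : 0 < M.l₁ := Real.sqrt_pos.2 p1
  have l2 : 0 < M.l₂ := Real.sqrt_pos.2 p2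
  have hk : 0 < M.k := Real.sqrt_pos.2 p3
  have e1 : M.l₁ ^ 2 = 4 * (M.ω₁ ^ 2 + M.n ^ 2 - 2 * M.F) := Real.sq_sqrt p1.le
  have e2 : M.l₂ ^ 2 = 4 * (M.ω₂ ^ 2 + M.n ^ 2 - 2 * M.F) := Real.sq_sqrt p2.le
  have e3 : M.k ^ 2 = M.ω₁ ^ 2 - M.ω₂ ^ 2 := Real.sq_sqrt p3.le
  have a1 : M.ω₁ ^ 2 - (2 * M.F - M.n ^ 2) = M.l₁ ^ 2 / 4 := by rw [e1]; ring
  have a2 : M.ω₂ ^ 2 - (2 * M.F - M.n ^ 2) = M.l₂ ^ 2 / 4 := by rw [e2]; ring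
  refine ⟨2 / (M.l₁ * M.k), 2 / (M.l₂ * M.k), hω₁, hω₂, ?_, ?_, ?_, ?_, ?_, ?_, ?_, ?_, ?_, ?_⟩
  · rw [a1, J₁₃]; field_simp; norm_num
  · rw [a2, J₁₄]; field_simp; norm_num
  · rw [J₂₁]; field_simp; ring
  · rw [J₂₂]; field_simp; ring
  · rw [J₂₃]; field_simp
  · rw [J₂₄]; field_simp
  · rw [a1, ← e3]; field_simp; norm_num
  · rw [a2, ← e3]; field_simp; norm_num
  · linear_combination -hs
  · linear_combination (-(2 * M.F - M.n ^ 2)) * hs + hp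

namespace IsNormalization

variable {s₁ s₂ : ℝ}

theorem J_mem_symplecticGroup (h : M.IsNormalization s₁ s₂) :
    M.J ∈ Matrix.symplecticGroup (Fin 2) ℝ := by
  have hω₁ := h.ω₁_pos.ne'
  have hω₂ := h.ω₂_pos.ne'
  have hG := h.G_sq
  rw [J, SymplecticGroup.fromBlocks_mem_iff, h.J₁₃_eq, h.J₁₄_eq, h.J₂₁_eq, h.J₂₂_eq, h.J₂₃_eq,
    h.J₂₄_eq]
  refine ⟨?_, ?_, ?_⟩
  · ext i j
    fin_cases i <;> fin_cases j <;>
      simp [Matrix.mul_apply, Fin.sum_univ_two] <;> field_simp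
  · ext i j
    fin_cases i <;> fin_cases j <;>
      simp [Matrix.mul_apply, Fin.sum_univ_two] <;> field_simp <;> ring
  · ext i j
    fin_cases i <;> fin_cases j <;>
      simp [Matrix.mul_apply, Fin.sum_univ_two] <;> field_simp
    -- Modulo the relation for `G²`, the diagonal entries are the normalizations of the two modes,
    -- and the mixed entries vanish.
    · linear_combination h.norm₁ + s₁ ^ 2 * hG
    · linear_combination (M.ω₁ * s₁ * s₂) * hG
    · linear_combination (-M.ω₂ * s₁ * s₂) * hG
    · linear_combination h.norm₂ - s₂ ^ 2 * hG

/-- Taking `√(2/ω₁)` as the common amplitude of `Q₁` and `P₁` leaves a single radical per mode. The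
identity holds for negative actions too, where both sides are zero. -/
theorem T_inr₀ (h : M.IsNormalization s₁ s₂) (I₁ I₂ φ₁ φ₂ : ℝ) :
    M.T I₁ I₂ φ₁ φ₂ (.inr 0) = M.ω₁ * (√(2 / M.ω₁) * cosMonomial 1 0 1 0 I₁ I₂ φ₁ φ₂) := by
  have h1 := h.ω₁_pos
  have e : √(2 * I₁ * M.ω₁) = M.ω₁ * (√(2 / M.ω₁) * √I₁) := by
    rw [← Real.sqrt_mul (by positivity)]
    nth_rw 2 [← Real.sqrt_sq h1.le]
    rw [← Real.sqrt_mul (by positivity)]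
    congr 1
    field_simp
  simp [T, cosMonomial, e]
  ring

theorem T_inr₁ (h : M.IsNormalization s₁ s₂) (I₁ I₂ φ₁ φ₂ : ℝ) :
    M.T I₁ I₂ φ₁ φ₂ (.inr 1) = M.ω₂ * (√(2 / M.ω₂) * cosMonomial 0 1 0 1 I₁ I₂ φ₁ φ₂) := by
  have h1 := h.ω₂_pos
  have e : √(2 * I₂ * M.ω₂) = M.ω₂ * (√(2 / M.ω₂) * √I₂) := by
    rw [← Real.sqrt_mul (by positivity)]
    nth_rw 2 [← Real.sqrt_sq h1.le]
    rw [← Real.sqrt_mul (by positivity)]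
    congr 1
    field_simp
  simp [T, cosMonomial, e]
  ring

theorem T_inl₀ (h : M.IsNormalization s₁ s₂) (I₁ I₂ φ₁ φ₂ : ℝ) :
    M.T I₁ I₂ φ₁ φ₂ (.inl 0) = √(2 / M.ω₁) * sinMonomial 1 0 1 0 I₁ I₂ φ₁ φ₂ := by
  have h1 := h.ω₁_pos
  have e : √(2 * I₁ / M.ω₁) = √(2 / M.ω₁) * √I₁ := by
    rw [← Real.sqrt_mul (by positivity)]
    congr 1
    ring
  simp [T, sinMonomial, e]
  ring

theorem T_inl₁ (h : M.IsNormalization s₁ s₂) (I₁ I₂ φ₁ φ₂ : ℝ) :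
    M.T I₁ I₂ φ₁ φ₂ (.inl 1) = √(2 / M.ω₂) * sinMonomial 0 1 0 1 I₁ I₂ φ₁ φ₂ := by
  have h1 := h.ω₂_pos
  have e : √(2 * I₂ / M.ω₂) = √(2 / M.ω₂) * √I₂ := by
    rw [← Real.sqrt_mul (by positivity)]
    congr 1
    ring
  simp [T, sinMonomial, e]
  ring

theorem H₂_eq (h : M.IsNormalization s₁ s₂) {I₁ I₂ : ℝ} (h₁ : 0 ≤ I₁) (h₂ : 0 ≤ I₂)
    (φ₁ φ₂ : ℝ) :
    M.H₂ (Matrix.mulVec M.J (M.T I₁ I₂ φ₁ φ₂)) = M.ω₁ * I₁ - M.ω₂ * I₂ := by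
  have hω₁ := h.ω₁_pos
  have hω₂ := h.ω₂_pos
  have hE : M.E = (M.ω₁ ^ 2 + M.ω₂ ^ 2 - (2 * M.F - M.n ^ 2) - 3 * M.n ^ 2) / 2 := by
    linear_combination h.sum_eq / 2
  have hG := h.G_sq
  -- Passing to `s_j/ω_j` clears the denominators of the entries.
  obtain ⟨t₁, ht₁⟩ : ∃ t, s₁ = M.ω₁ * t := ⟨s₁ / M.ω₁, by field_simp⟩
  obtain ⟨t₂, ht₂⟩ : ∃ t, s₂ = M.ω₂ * t := ⟨s₂ / M.ω₂, by field_simp⟩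
  have j₁₃ : M.J₁₃ = t₁ * (M.ω₁ ^ 2 - (2 * M.F - M.n ^ 2)) := by
    rw [h.J₁₃_eq, ht₁]; field_simp
  have j₁₄ : M.J₁₄ = t₂ * (M.ω₂ ^ 2 - (2 * M.F - M.n ^ 2)) := by
    rw [h.J₁₄_eq, ht₂]; field_simp
  have j₂₃ : M.J₂₃ = M.G * t₁ := by rw [h.J₂₃_eq, ht₁]; field_simp
  have j₂₄ : M.J₂₄ = M.G * t₂ := by rw [h.J₂₄_eq, ht₂]; field_simp
  have n1 : M.ω₁ * ((√(2 / M.ω₁) * cosMonomial 1 0 1 0 I₁ I₂ φ₁ φ₂) ^ 2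
      + (√(2 / M.ω₁) * sinMonomial 1 0 1 0 I₁ I₂ φ₁ φ₂) ^ 2) = 2 * I₁ := by
    simp only [cosMonomial, sinMonomial, mul_pow, Real.sq_sqrt h₁, pow_one, pow_zero, one_pow,
      Real.sq_sqrt (show 0 ≤ 2 / M.ω₁ by positivity)]
    rw [← mul_add, ← mul_add, Real.cos_sq_add_sin_sq]
    field_simp
  have n2 : M.ω₂ * ((√(2 / M.ω₂) * cosMonomial 0 1 0 1 I₁ I₂ φ₁ φ₂) ^ 2
      + (√(2 / M.ω₂) * sinMonomial 0 1 0 1 I₁ I₂ φ₁ φ₂) ^ 2) = 2 * I₂ := by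
    simp only [cosMonomial, sinMonomial, mul_pow, Real.sq_sqrt h₂, pow_one, pow_zero, one_pow,
      Real.sq_sqrt (show 0 ≤ 2 / M.ω₂ by positivity)]
    rw [← mul_add, ← mul_add, Real.cos_sq_add_sin_sq]
    field_simp
  simp only [H₂, Matrix.mulVec, dotProduct, Fintype.sum_sum_type, Fin.sum_univ_two, J,
    Matrix.fromBlocks_apply₁₁, Matrix.fromBlocks_apply₁₂, Matrix.fromBlocks_apply₂₁,
    Matrix.fromBlocks_apply₂₂, Matrix.cons_val', Matrix.cons_val_zero, Matrix.cons_val_one,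
    Matrix.of_apply, Matrix.cons_val_fin_one, h.T_inr₀, h.T_inr₁, h.T_inl₀, h.T_inl₁,
    j₁₃, j₁₄, h.J₂₁_eq, h.J₂₂_eq, j₂₃, j₂₄]
  -- From here on, only `n1` and `n2`, that is cos² + sin² = 1, are needed about the trigonometric
  -- factors.
  generalize √(2 / M.ω₁) * cosMonomial 1 0 1 0 I₁ I₂ φ₁ φ₂ = p₁ at *
  generalize √(2 / M.ω₁) * sinMonomial 1 0 1 0 I₁ I₂ φ₁ φ₂ = q₁ at *
  generalize √(2 / M.ω₂) * cosMonomial 0 1 0 1 I₁ I₂ φ₁ φ₂ = p₂ at *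
  generalize √(2 / M.ω₂) * sinMonomial 0 1 0 1 I₁ I₂ φ₁ φ₂ = q₂ at *
  rw [hE]
  have hb1 := h.norm₁
  have hb2 := h.norm₂
  rw [ht₁] at hb1 ⊢
  rw [ht₂] at hb2 ⊢
  obtain ⟨b, hb⟩ : ∃ b, 2 * M.F - M.n ^ 2 = b := ⟨_, rfl⟩
  have hF : M.F = (b + M.n ^ 2) / 2 := by linear_combination hb / 2
  rw [hb] at hb1 hb2 hG ⊢
  rw [hF]
  linear_combination (M.ω₁ ^ 2 * (p₁ ^ 2 + q₁ ^ 2) / 2) * hb1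
    - (M.ω₂ ^ 2 * (p₂ ^ 2 + q₂ ^ 2) / 2) * hb2 + M.ω₁ / 2 * n1 - M.ω₂ / 2 * n2
    + ((M.ω₁ * t₁) ^ 2 * ((2 * M.ω₁ ^ 2 - b) * p₁ ^ 2 + M.ω₁ ^ 2 * q₁ ^ 2) / 2
      + (M.ω₂ * t₂) ^ 2 * ((2 * M.ω₂ ^ 2 - b) * p₂ ^ 2 + M.ω₂ ^ 2 * q₂ ^ 2) / 2
      + M.ω₁ * t₁ * (M.ω₂ * t₂) * ((M.ω₁ ^ 2 + M.ω₂ ^ 2 - b) * (p₁ * p₂)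
        - M.ω₁ * M.ω₂ * (q₁ * q₂))) * hG

theorem B₁x_eq (h : M.IsNormalization s₁ s₂) : M.B₁x = fun I₁ I₂ φ₁ φ₂ =>
    s₁ * (M.ω₁ ^ 2 - (2 * M.F - M.n ^ 2)) * √(2 / M.ω₁) * cosMonomial 1 0 1 0 I₁ I₂ φ₁ φ₂
      + s₂ * (M.ω₂ ^ 2 - (2 * M.F - M.n ^ 2)) * √(2 / M.ω₂)
        * cosMonomial 0 1 0 1 I₁ I₂ φ₁ φ₂ := by
  have hω₁ := h.ω₁_pos
  have hω₂ := h.ω₂_pos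
  funext I₁ I₂ φ₁ φ₂
  simp only [B₁x, Matrix.mulVec, dotProduct, Fintype.sum_sum_type, Fin.sum_univ_two, J,
    Matrix.fromBlocks_apply₁₁, Matrix.fromBlocks_apply₁₂, Matrix.cons_val', Matrix.cons_val_zero,
    Matrix.cons_val_one, Matrix.of_apply, Matrix.cons_val_fin_one, h.T_inr₀, h.T_inr₁, h.J₁₃_eq,
    h.J₁₄_eq]
  field_simp
  ring

theorem B₁y_eq (h : M.IsNormalization s₁ s₂) : M.B₁y = fun I₁ I₂ φ₁ φ₂ =>
    (-(2 * M.n * M.ω₁) * s₁ * √(2 / M.ω₁) * sinMonomial 1 0 1 0 I₁ I₂ φ₁ φ₂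
      + M.G * s₁ * √(2 / M.ω₁) * cosMonomial 1 0 1 0 I₁ I₂ φ₁ φ₂)
      + (2 * M.n * M.ω₂ * s₂ * √(2 / M.ω₂) * sinMonomial 0 1 0 1 I₁ I₂ φ₁ φ₂
        + M.G * s₂ * √(2 / M.ω₂) * cosMonomial 0 1 0 1 I₁ I₂ φ₁ φ₂) := by
  have hω₁ := h.ω₁_pos
  have hω₂ := h.ω₂_pos
  funext I₁ I₂ φ₁ φ₂
  simp only [B₁y, Matrix.mulVec, dotProduct, Fintype.sum_sum_type, Fin.sum_univ_two, J,
    Matrix.fromBlocks_apply₁₁, Matrix.fromBlocks_apply₁₂, Matrix.cons_val', Matrix.cons_val_zero,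
    Matrix.cons_val_one, Matrix.of_apply, Matrix.cons_val_fin_one, h.T_inr₀, h.T_inr₁, h.T_inl₀,
    h.T_inl₁, h.J₂₁_eq, h.J₂₂_eq, h.J₂₃_eq, h.J₂₄_eq]
  field_simp
  ring

theorem isDAlembertComp_B₁x (h : M.IsNormalization s₁ s₂) : IsDAlembertComp 1 M.B₁x := by
  rw [h.B₁x_eq]
  have h1 := (IsDAlembertComp.monomial (a := 1) (m := 0) (p := 1) (q := 0)
    (by simp [IsDAlembertIndex])).1
  have h2 := (IsDAlembertComp.monomial (a := 0) (m := 1) (p := 0) (q := 1)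
    (by simp [IsDAlembertIndex])).1
  exact (h1.smul _).add (h2.smul _)

theorem isDAlembertComp_B₁y (h : M.IsNormalization s₁ s₂) : IsDAlembertComp 1 M.B₁y := by
  rw [h.B₁y_eq]
  have h1 := IsDAlembertComp.monomial (a := 1) (m := 0) (p := 1) (q := 0)
    (by simp [IsDAlembertIndex])
  have h2 := IsDAlembertComp.monomial (a := 0) (m := 1) (p := 0) (q := 1)
    (by simp [IsDAlembertIndex])
  exact ((h1.2.smul _).add (h1.1.smul _)).add ((h2.2.smul _).add (h2.1.smul _))

theorem D_B₁x (h : M.IsNormalization s₁ s₂) : M.D M.B₁x = fun I₁ I₂ φ₁ φ₂ =>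
    -(s₁ * (M.ω₁ ^ 2 - (2 * M.F - M.n ^ 2)) * √(2 / M.ω₁) * M.ω₁)
        * sinMonomial 1 0 1 0 I₁ I₂ φ₁ φ₂
      + s₂ * (M.ω₂ ^ 2 - (2 * M.F - M.n ^ 2)) * √(2 / M.ω₂) * M.ω₂
        * sinMonomial 0 1 0 1 I₁ I₂ φ₁ φ₂ := by
  rw [h.B₁x_eq]
  funext I₁ I₂ φ₁ φ₂
  rw [(((hasD_cosMonomial M 1 0 1 0 I₁ I₂ φ₁ φ₂).const_mul _).add
    ((hasD_cosMonomial M 0 1 0 1 I₁ I₂ φ₁ φ₂).const_mul _)).D_eq]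
  push_cast
  ring

theorem D_B₁y (h : M.IsNormalization s₁ s₂) : M.D M.B₁y = fun I₁ I₂ φ₁ φ₂ =>
    (-(2 * M.n * M.ω₁ ^ 2) * s₁ * √(2 / M.ω₁) * cosMonomial 1 0 1 0 I₁ I₂ φ₁ φ₂
      + -(M.G * M.ω₁ * s₁ * √(2 / M.ω₁)) * sinMonomial 1 0 1 0 I₁ I₂ φ₁ φ₂)
      + (-(2 * M.n * M.ω₂ ^ 2) * s₂ * √(2 / M.ω₂) * cosMonomial 0 1 0 1 I₁ I₂ φ₁ φ₂
        + M.G * M.ω₂ * s₂ * √(2 / M.ω₂) * sinMonomial 0 1 0 1 I₁ I₂ φ₁ φ₂) := by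
  rw [h.B₁y_eq]
  funext I₁ I₂ φ₁ φ₂
  rw [((((hasD_sinMonomial M 1 0 1 0 I₁ I₂ φ₁ φ₂).const_mul _).add
    ((hasD_cosMonomial M 1 0 1 0 I₁ I₂ φ₁ φ₂).const_mul _)).add
    (((hasD_sinMonomial M 0 1 0 1 I₁ I₂ φ₁ φ₂).const_mul _).add
    ((hasD_cosMonomial M 0 1 0 1 I₁ I₂ φ₁ φ₂).const_mul _))).D_eq]
  push_cast
  ring

/-- The first order components solve the linearized equations of motion. -/
theorem linear_eq_fst (h : M.IsNormalization s₁ s₂) (I₁ I₂ φ₁ φ₂ : ℝ) :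
    M.D (M.D M.B₁x) I₁ I₂ φ₁ φ₂ = 2 * M.n * M.D M.B₁y I₁ I₂ φ₁ φ₂
      - (2 * M.E - M.n ^ 2) * M.B₁x I₁ I₂ φ₁ φ₂ - M.G * M.B₁y I₁ I₂ φ₁ φ₂ := by
  rw [h.D_B₁x, h.D_B₁y, h.B₁x_eq, h.B₁y_eq, h.sum_eq]
  rw [(((hasD_sinMonomial M 1 0 1 0 I₁ I₂ φ₁ φ₂).const_mul _).add
    ((hasD_sinMonomial M 0 1 0 1 I₁ I₂ φ₁ φ₂).const_mul _)).D_eq]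
  have hG := h.G_sq
  push_cast
  linear_combination (s₁ * √(2 / M.ω₁) * cosMonomial 1 0 1 0 I₁ I₂ φ₁ φ₂
    + s₂ * √(2 / M.ω₂) * cosMonomial 0 1 0 1 I₁ I₂ φ₁ φ₂) * hG

theorem linear_eq_snd (h : M.IsNormalization s₁ s₂) (I₁ I₂ φ₁ φ₂ : ℝ) :
    M.D (M.D M.B₁y) I₁ I₂ φ₁ φ₂ = -(2 * M.n * M.D M.B₁x I₁ I₂ φ₁ φ₂)
      - M.G * M.B₁x I₁ I₂ φ₁ φ₂ - (2 * M.F - M.n ^ 2) * M.B₁y I₁ I₂ φ₁ φ₂ := by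
  rw [h.D_B₁x, h.D_B₁y, h.B₁x_eq, h.B₁y_eq]
  rw [((((hasD_cosMonomial M 1 0 1 0 I₁ I₂ φ₁ φ₂).const_mul _).add
    ((hasD_sinMonomial M 1 0 1 0 I₁ I₂ φ₁ φ₂).const_mul _)).add
    (((hasD_cosMonomial M 0 1 0 1 I₁ I₂ φ₁ φ₂).const_mul _).add
    ((hasD_sinMonomial M 0 1 0 1 I₁ I₂ φ₁ φ₂).const_mul _))).D_eq]
  push_cast
  ring

end IsNormalization

end LinearPart

end PRModel

theorem deriv_cubic (k₀ k₁ k₂ k₃ x : ℝ) :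
    deriv (fun t : ℝ => k₀ + k₁ * t + k₂ * t ^ 2 + k₃ * t ^ 3) x
      = k₁ + 2 * k₂ * x + 3 * k₃ * x ^ 2 := by
  have h := ((((hasDerivAt_id' x).const_mul k₁).const_add k₀).add
    ((hasDerivAt_pow 2 x).const_mul k₂)).add ((hasDerivAt_pow 3 x).const_mul k₃)
  refine (h.congr_deriv ?_).deriv
  norm_num
  ring

theorem dAlembertComp_neg (k : ℕ) (C S : ℕ → ℕ → ℤ → ℝ) :
    -dAlembertComp k C S = dAlembertComp k (fun m p q => -C m p q) (fun m p q => -S m p q) := by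
  rw [← neg_one_smul ℝ (dAlembertComp k C S), dAlembertComp_smul, neg_one_smul, neg_one_smul]
  rfl

/-! ### Non-resonance and the second-order equations. -/

namespace PRModel

variable {M : PRModel}

section NonResonance

/-- The parities of `3 - m` and `m` differ, so `p` and `q` cannot both be zero; moreover `|p| + |q|
≤ 3`. -/
theorem freq_ne_zero_of_degree_three (hres : M.NonResonant) {m p : ℕ} {q : ℤ}
    (hm : m ∈ Finset.range (3 + 1)) (hp : p ∈ dAlembertP (3 - m)) (hq : q ∈ dAlembertQ m) :
    M.freq p q ≠ 0 := by
  rw [Finset.mem_range] at hm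
  rw [mem_dAlembertP] at hp
  rw [mem_dAlembertQ] at hq
  have h := hres p (-q) (by rw [Ne, Prod.mk.injEq]; omega)
    (by simp only [abs_eq_max_neg]; omega)
  rw [freq]
  push_cast at h
  intro h0
  exact h (by linear_combination h0)

/-- `Δ` splits into four integer combinations of the frequencies, of order at most three. In degree
two `p` and `q` have equal parity, so shifting one of them by one makes the sum odd and the
combination nontrivial. -/
theorem Δ_ne_zero_of_degree_two (hres : M.NonResonant) {m p : ℕ} {q : ℤ}
    (hm : m ∈ Finset.range (2 + 1)) (hp : p ∈ dAlembertP (2 - m)) (hq : q ∈ dAlembertQ m) :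
    M.Δ p q ≠ 0 := by
  rw [Finset.mem_range] at hm
  rw [mem_dAlembertP] at hp
  rw [mem_dAlembertQ] at hq
  have h1 := hres (1 - p) q (by rw [Ne, Prod.mk.injEq]; omega)
    (by simp only [abs_eq_max_neg]; omega)
  have h2 := hres (1 + p) (-q) (by rw [Ne, Prod.mk.injEq]; omega)
    (by simp only [abs_eq_max_neg]; omega)
  have h3 := hres p (-q - 1) (by rw [Ne, Prod.mk.injEq]; omega)
    (by simp only [abs_eq_max_neg]; omega)
  have h4 := hres p (-q + 1) (by rw [Ne, Prod.mk.injEq]; omega)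
    (by simp only [abs_eq_max_neg]; omega)
  push_cast at h1 h2 h3 h4
  have e : M.Δ p q = ((1 - p) * M.ω₁ + q * M.ω₂) * ((1 + p) * M.ω₁ + -q * M.ω₂)
      * (-((p * M.ω₁ + (-q - 1) * M.ω₂) * (p * M.ω₁ + (-q + 1) * M.ω₂))) := by
    rw [Δ]; ring
  rw [e]
  exact mul_ne_zero (mul_ne_zero h1 h2) (neg_ne_zero.2 (mul_ne_zero h3 h4))

end NonResonance

/-- The right-hand side is the determinant of the second-order system with `D²` replaced by
`-freq²`. -/
theorem Δ_eq (hfreq : M.HasFrequencies) (p : ℕ) (q : ℤ) :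
    M.Δ p q = (2 * M.E - M.n ^ 2 - M.freq p q ^ 2) * (2 * M.F - M.n ^ 2 - M.freq p q ^ 2)
      - 4 * M.n ^ 2 * M.freq p q ^ 2 - M.G ^ 2 := by
  obtain ⟨hs, hp⟩ := frequencies_vieta hfreq
  rw [Δ, ← freq]
  linear_combination hp - M.freq p q ^ 2 * hs

/-- A second order operator `(D² + e) f + (r D + s) g` in terms of the coefficients. -/
theorem operator_dAlembertComp (M : PRModel) (k : ℕ) (C S C' S' : ℕ → ℕ → ℤ → ℝ)
    (e r s I₁ I₂ φ₁ φ₂ : ℝ) :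
    M.D (M.D (dAlembertComp k C S)) I₁ I₂ φ₁ φ₂ + e * dAlembertComp k C S I₁ I₂ φ₁ φ₂
        + (r * M.D (dAlembertComp k C' S') I₁ I₂ φ₁ φ₂
          + s * dAlembertComp k C' S' I₁ I₂ φ₁ φ₂)
      = dAlembertComp k
        (fun m p q => (e - M.freq p q ^ 2) * C m p q
          + (r * M.freq p q * S' m p q + s * C' m p q))
        (fun m p q => (e - M.freq p q ^ 2) * S m p q
          + (-(r * M.freq p q * C' m p q) + s * S' m p q)) I₁ I₂ φ₁ φ₂ := by
  rw [D_dAlembertComp, D_dAlembertComp, D_dAlembertComp]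
  have key : dAlembertComp k
        (fun m p q => (e - M.freq p q ^ 2) * C m p q
          + (r * M.freq p q * S' m p q + s * C' m p q))
        (fun m p q => (e - M.freq p q ^ 2) * S m p q
          + (-(r * M.freq p q * C' m p q) + s * S' m p q))
      = (dAlembertComp k (fun m p q => M.freq p q * -(M.freq p q * C m p q))
          (fun m p q => -(M.freq p q * (M.freq p q * S m p q))) + e • dAlembertComp k C S)
        + (r • dAlembertComp k (fun m p q => M.freq p q * S' m p q)
          (fun m p q => -(M.freq p q * C' m p q)) + s • dAlembertComp k C' S') := by
    simp only [dAlembertComp_smul, dAlembertComp_add]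
    congr 1
    all_goals
      funext m p q
      simp
      ring
  rw [key]
  simp only [Pi.add_apply, Pi.smul_apply, smul_eq_mul]

theorem operator_eq_zero {k : ℕ} {C S C' S' : ℕ → ℕ → ℤ → ℝ} (h : dAlembertComp k C S = 0)
    (h' : dAlembertComp k C' S' = 0) (M : PRModel) (e r s : ℝ) :
    dAlembertComp k
        (fun m p q => (e - M.freq p q ^ 2) * C m p q
          + (r * M.freq p q * S' m p q + s * C' m p q))
        (fun m p q => (e - M.freq p q ^ 2) * S m p q
          + (-(r * M.freq p q * C' m p q) + s * S' m p q)) = 0 := by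
  funext I₁ I₂ φ₁ φ₂
  rw [← operator_dAlembertComp, h, h', D_zero, D_zero]
  simp

section SecondOrder

variable {CX SX CY SY : ℕ → ℕ → ℤ → ℝ}

theorem solvesSecondOrder_dAlembertComp_iff (hX : M.X₂.Agree (dAlembertComp 2 CX SX))
    (hY : M.Y₂.Agree (dAlembertComp 2 CY SY)) (C S C' S' : ℕ → ℕ → ℤ → ℝ) :
    M.SolvesSecondOrder (dAlembertComp 2 C S) (dAlembertComp 2 C' S') ↔
      dAlembertComp 2
        (fun m p q => (2 * M.E - M.n ^ 2 - M.freq p q ^ 2) * C m p q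
          + (-(2 * M.n) * M.freq p q * S' m p q + M.G * C' m p q))
        (fun m p q => (2 * M.E - M.n ^ 2 - M.freq p q ^ 2) * S m p q
          + (-(-(2 * M.n) * M.freq p q * C' m p q) + M.G * S' m p q)) = dAlembertComp 2 CX SX ∧
      dAlembertComp 2
        (fun m p q => (2 * M.F - M.n ^ 2 - M.freq p q ^ 2) * C' m p q
          + (2 * M.n * M.freq p q * S m p q + M.G * C m p q))
        (fun m p q => (2 * M.F - M.n ^ 2 - M.freq p q ^ 2) * S' m p q
          + (-(2 * M.n * M.freq p q * C m p q) + M.G * S m p q)) = dAlembertComp 2 CY SY := by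
  have h1 := operator_dAlembertComp M 2 C S C' S' (2 * M.E - M.n ^ 2) (-(2 * M.n)) M.G
  have h2 := operator_dAlembertComp M 2 C' S' C S (2 * M.F - M.n ^ 2) (2 * M.n) M.G
  refine and_congr ⟨fun h => ?_, fun h => ?_⟩ ⟨fun h => ?_, fun h => ?_⟩
  · refine dAlembertComp_eq_of_agree (ActionAngleFun.Agree.trans ?_ (h.trans hX))
    intro I₁ I₂ φ₁ φ₂ _ _
    beta_reduce
    rw [← h1]
    ring
  · refine ActionAngleFun.Agree.trans ?_ hX.symm
    intro I₁ I₂ φ₁ φ₂ _ _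
    beta_reduce
    rw [← h, ← h1]
    ring
  · refine dAlembertComp_eq_of_agree (ActionAngleFun.Agree.trans ?_ (h.trans hY))
    intro I₁ I₂ φ₁ φ₂ _ _
    beta_reduce
    rw [← h2]
    ring
  · refine ActionAngleFun.Agree.trans ?_ hY.symm
    intro I₁ I₂ φ₁ φ₂ _ _
    beta_reduce
    rw [← h, ← h2]
    ring

theorem Φ₂_agree (hX : M.X₂.Agree (dAlembertComp 2 CX SX))
    (hY : M.Y₂.Agree (dAlembertComp 2 CY SY)) :
    M.Φ₂.Agree (dAlembertComp 2
      (fun m p q => (2 * M.F - M.n ^ 2 - M.freq p q ^ 2) * CX m p q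
        + (2 * M.n * M.freq p q * SY m p q + -M.G * CY m p q))
      (fun m p q => (2 * M.F - M.n ^ 2 - M.freq p q ^ 2) * SX m p q
        + (-(2 * M.n * M.freq p q * CY m p q) + -M.G * SY m p q))) := by
  intro I₁ I₂ φ₁ φ₂ h₁ h₂
  rw [← operator_dAlembertComp, Φ₂, (hX.D M).D M _ _ _ _ h₁ h₂, hX _ _ _ _ h₁ h₂,
    hY.D M _ _ _ _ h₁ h₂, hY _ _ _ _ h₁ h₂]
  ring

theorem neg_Ψ₂_agree (hX : M.X₂.Agree (dAlembertComp 2 CX SX))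
    (hY : M.Y₂.Agree (dAlembertComp 2 CY SY)) :
    ActionAngleFun.Agree (fun I₁ I₂ φ₁ φ₂ => -M.Ψ₂ I₁ I₂ φ₁ φ₂) (dAlembertComp 2
      (fun m p q => (2 * M.E - M.n ^ 2 - M.freq p q ^ 2) * CY m p q
        + (-(2 * M.n) * M.freq p q * SX m p q + -M.G * CX m p q))
      (fun m p q => (2 * M.E - M.n ^ 2 - M.freq p q ^ 2) * SY m p q
        + (-(-(2 * M.n) * M.freq p q * CX m p q) + -M.G * SX m p q))) := by
  intro I₁ I₂ φ₁ φ₂ h₁ h₂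
  beta_reduce
  rw [← operator_dAlembertComp, Ψ₂, (hY.D M).D M _ _ _ _ h₁ h₂, hX _ _ _ _ h₁ h₂,
    hX.D M _ _ _ _ h₁ h₂, hY _ _ _ _ h₁ h₂]
  ring

/-- The two second order equations are solved by division of coefficients. -/
theorem exists_solvesSecondOrder (hfreq : M.HasFrequencies) (hres : M.NonResonant)
    (hX : M.X₂.Agree (dAlembertComp 2 CX SX)) (hY : M.Y₂.Agree (dAlembertComp 2 CY SY)) :
    ∃ CΦ SΦ CΨ SΨ : ℕ → ℕ → ℤ → ℝ,
      M.Φ₂.Agree (dAlembertComp 2 CΦ SΦ) ∧ M.Ψ₂.Agree (dAlembertComp 2 CΨ SΨ) ∧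
      M.SolvesSecondOrder
        (dAlembertComp 2 (fun m p q => CΦ m p q / M.Δ p q) (fun m p q => SΦ m p q / M.Δ p q))
        (dAlembertComp 2 (fun m p q => -CΨ m p q / M.Δ p q)
          (fun m p q => -SΨ m p q / M.Δ p q)) := by
  refine ⟨_, _, fun m p q => -((2 * M.E - M.n ^ 2 - M.freq p q ^ 2) * CY m p q
      + (-(2 * M.n) * M.freq p q * SX m p q + -M.G * CX m p q)),
    fun m p q => -((2 * M.E - M.n ^ 2 - M.freq p q ^ 2) * SY m p q
      + (-(-(2 * M.n) * M.freq p q * CX m p q) + -M.G * SX m p q)), Φ₂_agree hX hY,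
    fun I₁ I₂ φ₁ φ₂ h₁ h₂ => ?_, ?_⟩
  · have h : -M.Ψ₂ I₁ I₂ φ₁ φ₂ = _ := neg_Ψ₂_agree hX hY I₁ I₂ φ₁ φ₂ h₁ h₂
    rw [← dAlembertComp_neg, ← neg_neg (M.Ψ₂ I₁ I₂ φ₁ φ₂), h]
    rfl
  · rw [solvesSecondOrder_dAlembertComp_iff hX hY]
    constructor
    -- Cramer's rule: `(Φ₂, -Ψ₂)` is the adjugate applied to `(X₂, Y₂)`, so the system multiplies it
    -- by the determinant `Δ`, which the division cancels.
    all_goals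
      refine dAlembertComp_congr fun m hm p hp q hq => ?_
      have h0 := Δ_ne_zero_of_degree_two hres hm hp hq
      have he := Δ_eq hfreq p q
      constructor <;> field_simp <;> rw [he] <;> ring

/-- The difference of two solutions solves the homogeneous system. The adjugate decouples it into
the multiplier `Δ`, a function of `freq²` without zeros on the spectrum, acting on each component.
-/
theorem secondOrder_unique (hfreq : M.HasFrequencies) (hres : M.NonResonant)
    (hX : M.X₂.Agree (dAlembertComp 2 CX SX)) (hY : M.Y₂.Agree (dAlembertComp 2 CY SY))
    {Cx Sx Cy Sy Cx' Sx' Cy' Sy' : ℕ → ℕ → ℤ → ℝ}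
    (h : M.SolvesSecondOrder (dAlembertComp 2 Cx Sx) (dAlembertComp 2 Cy Sy))
    (h' : M.SolvesSecondOrder (dAlembertComp 2 Cx' Sx') (dAlembertComp 2 Cy' Sy')) :
    dAlembertComp 2 Cx Sx = dAlembertComp 2 Cx' Sx' ∧
      dAlembertComp 2 Cy Sy = dAlembertComp 2 Cy' Sy' := by
  rw [solvesSecondOrder_dAlembertComp_iff hX hY] at h h'
  obtain ⟨a1, a2⟩ := h
  obtain ⟨b1, b2⟩ := h'
  have sub_eq (C S C' S' : ℕ → ℕ → ℤ → ℝ) : dAlembertComp 2 C S - dAlembertComp 2 C' S'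
      = dAlembertComp 2 (C - C') (S - S') := by
    rw [sub_eq_add_neg, ← neg_one_smul ℝ (dAlembertComp 2 C' S'), dAlembertComp_smul,
      dAlembertComp_add, neg_one_smul, neg_one_smul, ← sub_eq_add_neg, ← sub_eq_add_neg]
  have z1 := sub_eq_zero.2 (a1.trans b1.symm)
  have z2 := sub_eq_zero.2 (a2.trans b2.symm)
  rw [sub_eq] at z1 z2
  have hσ : ∀ m ∈ Finset.range (2 + 1), ∀ p ∈ dAlembertP (2 - m), ∀ q ∈ dAlembertQ m,
      (fun z => (M.ω₁ ^ 2 - z) * (M.ω₂ ^ 2 - z)) (M.freq p q ^ 2) ≠ 0 :=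
    fun m hm p hp q hq => Δ_ne_zero_of_degree_two hres hm hp hq
  have hΔ (p : ℕ) (q : ℤ) : (M.ω₁ ^ 2 - M.freq p q ^ 2) * (M.ω₂ ^ 2 - M.freq p q ^ 2)
      = (2 * M.E - M.n ^ 2 - M.freq p q ^ 2) * (2 * M.F - M.n ^ 2 - M.freq p q ^ 2)
        - 4 * M.n ^ 2 * M.freq p q ^ 2 - M.G ^ 2 := Δ_eq hfreq p q
  constructor
  · rw [← sub_eq_zero, sub_eq]
    refine dAlembertComp_eq_zero_of_multiplier (M := M)
      (fun z => (M.ω₁ ^ 2 - z) * (M.ω₂ ^ 2 - z)) hσ ?_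
    refine Eq.trans ?_ (operator_eq_zero z1 z2 M (2 * M.F - M.n ^ 2) (2 * M.n) (-M.G))
    congr 1
    all_goals
      funext m p q
      simp only [Pi.sub_apply, hΔ]
      ring
  · rw [← sub_eq_zero, sub_eq]
    refine dAlembertComp_eq_zero_of_multiplier (M := M)
      (fun z => (M.ω₁ ^ 2 - z) * (M.ω₂ ^ 2 - z)) hσ ?_
    refine Eq.trans ?_ (operator_eq_zero z2 z1 M (2 * M.E - M.n ^ 2) (-(2 * M.n)) (-M.G))
    congr 1
    all_goals
      funext m p q
      simp only [Pi.sub_apply, hΔ]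
      ring

theorem SolvesSecondOrder.congr {Bx By Bx' By' : ActionAngleFun}
    (h : M.SolvesSecondOrder Bx By) (hx : Bx.Agree Bx') (hy : By.Agree By') :
    M.SolvesSecondOrder Bx' By' := by
  refine ⟨fun I₁ I₂ φ₁ φ₂ h₁ h₂ => ?_, fun I₁ I₂ φ₁ φ₂ h₁ h₂ => ?_⟩
  · refine Eq.trans ?_ (h.1 _ _ _ _ h₁ h₂)
    beta_reduce
    rw [hx _ _ _ _ h₁ h₂, (hx.D M).D M _ _ _ _ h₁ h₂, hy _ _ _ _ h₁ h₂, hy.D M _ _ _ _ h₁ h₂]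
  · refine Eq.trans ?_ (h.2 _ _ _ _ h₁ h₂)
    beta_reduce
    rw [hx _ _ _ _ h₁ h₂, (hy.D M).D M _ _ _ _ h₁ h₂, hy _ _ _ _ h₁ h₂, hx.D M _ _ _ _ h₁ h₂]

end SecondOrder

/-- A homogeneous component of degree three which is constant along the linear flow vanishes. -/
theorem eq_zero_of_D_eq_zero (hres : M.NonResonant) {f : ActionAngleFun}
    (hf : IsDAlembertComp 3 f) (hD : (M.D f).Agree 0) : f.Agree 0 := by
  obtain ⟨C, S, h⟩ := hf
  -- `D` itself exchanges sines and cosines; applying it twice gives the multiplier `-freq²`.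
  have h2 := ((h.D M).D M).symm.trans (hD.D M)
  rw [D_zero, D_dAlembertComp, D_dAlembertComp, ← dAlembertComp_zero 3] at h2
  have h3 := dAlembertComp_eq_of_agree h2
  rw [dAlembertComp_zero] at h3
  have h4 : dAlembertComp 3 C S = 0 := by
    refine dAlembertComp_eq_zero_of_multiplier (M := M) (fun z => -z) ?_ (Eq.trans ?_ h3)
    · intro m hm p hp q hq
      exact neg_ne_zero.2 (pow_ne_zero 2 (freq_ne_zero_of_degree_three hres hm hp hq))
    · congr 1
      all_goals
        funext m p q
        ring
  rwa [h4] at h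

/-! ### The forcing terms and the energy at third order. -/

namespace IsJet

variable {s₁ s₂ c₃₀ c₂₁ c₁₂ c₀₃ d₀ d₁ d₂ d₃ : ℝ}

/-- The velocity terms of `L₃` form a closed one-form, whose Lagrange expression is zero; only the
gradient of the cubic potential survives. -/
theorem X₂_agree (hj : M.IsJet c₃₀ c₂₁ c₁₂ c₀₃ d₀ d₁ d₂ d₃) (h : M.IsNormalization s₁ s₂) :
    M.X₂.Agree ((3 * c₃₀) • (M.B₁x * M.B₁x) + (2 * c₂₁) • (M.B₁x * M.B₁y)
      + c₁₂ • (M.B₁y * M.B₁y)) := by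
  intro I₁ I₂ φ₁ φ₂ h₁ h₂
  have e1 (x y u v : ℝ) : deriv (fun t => M.Lpart 3 t y u v) x
      = 3 * c₃₀ * x ^ 2 + 2 * c₂₁ * (x * y) + c₁₂ * y ^ 2 + (2 * d₀ * x + 2 * d₁ * y) * u
        + (2 * d₁ * x + 2 * d₂ * y) * v := by
    have e := deriv_cubic (c₀₃ * y ^ 3 + d₂ * y ^ 2 * u + d₃ * y ^ 2 * v)
      (c₁₂ * y ^ 2 + 2 * d₁ * y * u + 2 * d₂ * y * v) (c₂₁ * y + d₀ * u + d₁ * v) c₃₀ x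
    have : (fun t => M.Lpart 3 t y u v) = _ :=
      (funext fun t => by rw [hj.Lpart_three]; ring).trans (Eq.refl (fun t : ℝ =>
        (c₀₃ * y ^ 3 + d₂ * y ^ 2 * u + d₃ * y ^ 2 * v)
        + (c₁₂ * y ^ 2 + 2 * d₁ * y * u + 2 * d₂ * y * v) * t
        + (c₂₁ * y + d₀ * u + d₁ * v) * t ^ 2 + c₃₀ * t ^ 3))
    rw [this, e]
    ring
  have e2 (x y u v : ℝ) : deriv (fun t => M.Lpart 3 x y t v) u
      = d₀ * (x * x) + 2 * d₁ * (x * y) + d₂ * (y * y) := by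
    have e := deriv_cubic (c₃₀ * x ^ 3 + c₂₁ * (x ^ 2 * y) + c₁₂ * (x * y ^ 2) + c₀₃ * y ^ 3
      + (d₁ * x ^ 2 + 2 * d₂ * (x * y) + d₃ * y ^ 2) * v)
      (d₀ * x ^ 2 + 2 * d₁ * (x * y) + d₂ * y ^ 2) 0 0 u
    have : (fun t => M.Lpart 3 x y t v) = _ :=
      (funext fun t => by rw [hj.Lpart_three]; ring).trans (Eq.refl (fun t : ℝ =>
        (c₃₀ * x ^ 3 + c₂₁ * (x ^ 2 * y) + c₁₂ * (x * y ^ 2) + c₀₃ * y ^ 3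
        + (d₁ * x ^ 2 + 2 * d₂ * (x * y) + d₃ * y ^ 2) * v)
        + (d₀ * x ^ 2 + 2 * d₁ * (x * y) + d₂ * y ^ 2) * t + 0 * t ^ 2 + 0 * t ^ 3))
    rw [this, e]
    ring
  have hx := h.isDAlembertComp_B₁x.hasD M h₁ h₂ φ₁ φ₂
  have hy := h.isDAlembertComp_B₁y.hasD M h₁ h₂ φ₁ φ₂
  have hd := ((((hx.mul hx).const_mul d₀).add ((hx.mul hy).const_mul (2 * d₁))).add
    ((hy.mul hy).const_mul d₂)).D_eq
  have hd' : M.D (M.alongFirstOrder fun x y _ _ =>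
      d₀ * (x * x) + 2 * d₁ * (x * y) + d₂ * (y * y)) I₁ I₂ φ₁ φ₂ = _ := hd
  simp only [X₂, e1, e2]
  rw [hd']
  simp only [alongFirstOrder, Pi.add_apply, Pi.smul_apply, Pi.mul_apply, smul_eq_mul]
  ring

theorem Y₂_agree (hj : M.IsJet c₃₀ c₂₁ c₁₂ c₀₃ d₀ d₁ d₂ d₃) (h : M.IsNormalization s₁ s₂) :
    M.Y₂.Agree (c₂₁ • (M.B₁x * M.B₁x) + (2 * c₁₂) • (M.B₁x * M.B₁y)
      + (3 * c₀₃) • (M.B₁y * M.B₁y)) := by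
  intro I₁ I₂ φ₁ φ₂ h₁ h₂
  have e1 (x y u v : ℝ) : deriv (fun t => M.Lpart 3 x t u v) y
      = c₂₁ * x ^ 2 + 2 * c₁₂ * (x * y) + 3 * c₀₃ * y ^ 2 + (2 * d₁ * x + 2 * d₂ * y) * u
        + (2 * d₂ * x + 2 * d₃ * y) * v := by
    have e := deriv_cubic (c₃₀ * x ^ 3 + d₀ * x ^ 2 * u + d₁ * x ^ 2 * v)
      (c₂₁ * x ^ 2 + 2 * d₁ * x * u + 2 * d₂ * x * v) (c₁₂ * x + d₂ * u + d₃ * v) c₀₃ y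
    have : (fun t => M.Lpart 3 x t u v) = _ :=
      (funext fun t => by rw [hj.Lpart_three]; ring).trans (Eq.refl (fun t : ℝ =>
        (c₃₀ * x ^ 3 + d₀ * x ^ 2 * u + d₁ * x ^ 2 * v)
        + (c₂₁ * x ^ 2 + 2 * d₁ * x * u + 2 * d₂ * x * v) * t
        + (c₁₂ * x + d₂ * u + d₃ * v) * t ^ 2 + c₀₃ * t ^ 3))
    rw [this, e]
    ring
  have e2 (x y u v : ℝ) : deriv (fun t => M.Lpart 3 x y u t) v
      = d₁ * (x * x) + 2 * d₂ * (x * y) + d₃ * (y * y) := by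
    have e := deriv_cubic (c₃₀ * x ^ 3 + c₂₁ * (x ^ 2 * y) + c₁₂ * (x * y ^ 2) + c₀₃ * y ^ 3
      + (d₀ * x ^ 2 + 2 * d₁ * (x * y) + d₂ * y ^ 2) * u)
      (d₁ * x ^ 2 + 2 * d₂ * (x * y) + d₃ * y ^ 2) 0 0 v
    have : (fun t => M.Lpart 3 x y u t) = _ :=
      (funext fun t => by rw [hj.Lpart_three]; ring).trans (Eq.refl (fun t : ℝ =>
        (c₃₀ * x ^ 3 + c₂₁ * (x ^ 2 * y) + c₁₂ * (x * y ^ 2) + c₀₃ * y ^ 3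
        + (d₀ * x ^ 2 + 2 * d₁ * (x * y) + d₂ * y ^ 2) * u)
        + (d₁ * x ^ 2 + 2 * d₂ * (x * y) + d₃ * y ^ 2) * t + 0 * t ^ 2 + 0 * t ^ 3))
    rw [this, e]
    ring
  have hx := h.isDAlembertComp_B₁x.hasD M h₁ h₂ φ₁ φ₂
  have hy := h.isDAlembertComp_B₁y.hasD M h₁ h₂ φ₁ φ₂
  have hd := ((((hx.mul hx).const_mul d₁).add ((hx.mul hy).const_mul (2 * d₂))).add
    ((hy.mul hy).const_mul d₃)).D_eq
  have hd' : M.D (M.alongFirstOrder fun x y _ _ =>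
      d₁ * (x * x) + 2 * d₂ * (x * y) + d₃ * (y * y)) I₁ I₂ φ₁ φ₂ = _ := hd
  simp only [Y₂, e1, e2]
  rw [hd']
  simp only [alongFirstOrder, Pi.add_apply, Pi.smul_apply, Pi.mul_apply, smul_eq_mul]
  ring

theorem H₃_eq (hj : M.IsJet c₃₀ c₂₁ c₁₂ c₀₃ d₀ d₁ d₂ d₃) (Bx By : ActionAngleFun) :
    M.H₃ Bx By = M.D M.B₁x * M.D Bx + M.D M.B₁y * M.D By
      + (-c₃₀) • (M.B₁x * (M.B₁x * M.B₁x)) + (-c₂₁) • (M.B₁x * (M.B₁x * M.B₁y))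
      + (-c₁₂) • (M.B₁x * (M.B₁y * M.B₁y)) + (-c₀₃) • (M.B₁y * (M.B₁y * M.B₁y))
      + (2 * M.E - M.n ^ 2) • (M.B₁x * Bx) + M.G • (M.B₁x * By) + M.G • (M.B₁y * Bx)
      + (2 * M.F - M.n ^ 2) • (M.B₁y * By) := by
  funext I₁ I₂ φ₁ φ₂
  rw [H₃, hj.H_three]
  simp only [Pi.add_apply, Pi.smul_apply, Pi.mul_apply, smul_eq_mul]
  ring

/-- The third order part of the energy vanishes along the second order solution. -/
theorem H₃_agree_zero (hj : M.IsJet c₃₀ c₂₁ c₁₂ c₀₃ d₀ d₁ d₂ d₃) (h : M.IsNormalization s₁ s₂)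
    (hres : M.NonResonant) {Bx By : ActionAngleFun} (hBx : IsDAlembertComp 2 Bx)
    (hBy : IsDAlembertComp 2 By) (hB : M.SolvesSecondOrder Bx By) :
    (M.H₃ Bx By).Agree 0 := by
  have hx := h.isDAlembertComp_B₁x
  have hy := h.isDAlembertComp_B₁y
  rw [hj.H₃_eq]
  refine eq_zero_of_D_eq_zero hres ?_ ?_
  · exact (((((((((((hx.D M).mul (hBx.D M)).add ((hy.D M).mul (hBy.D M))).add
      ((hx.mul (hx.mul hx)).smul _)).add ((hx.mul (hx.mul hy)).smul _)).add
      ((hx.mul (hy.mul hy)).smul _)).add ((hy.mul (hy.mul hy)).smul _)).add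
      ((hx.mul hBx).smul _)).add ((hx.mul hBy).smul _)).add ((hy.mul hBx).smul _)).add
      ((hy.mul hBy).smul _))
  · intro I₁ I₂ φ₁ φ₂ h₁ h₂
    have x0 := hx.hasD M h₁ h₂ φ₁ φ₂
    have y0 := hy.hasD M h₁ h₂ φ₁ φ₂
    have x1 := (hx.D M).hasD M h₁ h₂ φ₁ φ₂
    have y1 := (hy.D M).hasD M h₁ h₂ φ₁ φ₂
    have X0 := hBx.hasD M h₁ h₂ φ₁ φ₂
    have Y0 := hBy.hasD M h₁ h₂ φ₁ φ₂
    have X1 := (hBx.D M).hasD M h₁ h₂ φ₁ φ₂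
    have Y1 := (hBy.D M).hasD M h₁ h₂ φ₁ φ₂
    have hD := ((((((((((x1.mul X1).add (y1.mul Y1)).add
      ((x0.mul (x0.mul x0)).const_mul (-c₃₀))).add ((x0.mul (x0.mul y0)).const_mul (-c₂₁))).add
      ((x0.mul (y0.mul y0)).const_mul (-c₁₂))).add ((y0.mul (y0.mul y0)).const_mul (-c₀₃))).add
      ((x0.mul X0).const_mul (2 * M.E - M.n ^ 2))).add ((x0.mul Y0).const_mul M.G)).add
      ((y0.mul X0).const_mul M.G)).add ((y0.mul Y0).const_mul (2 * M.F - M.n ^ 2))).D_eq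
    refine Eq.trans hD ?_
    have eX := (hB.1 I₁ I₂ φ₁ φ₂ h₁ h₂).trans (hj.X₂_agree h I₁ I₂ φ₁ φ₂ h₁ h₂)
    have eY := (hB.2 I₁ I₂ φ₁ φ₂ h₁ h₂).trans (hj.Y₂_agree h I₁ I₂ φ₁ φ₂ h₁ h₂)
    have ex := h.linear_eq_fst I₁ I₂ φ₁ φ₂
    have ey := h.linear_eq_snd I₁ I₂ φ₁ φ₂
    simp only [Pi.add_apply, Pi.smul_apply, Pi.mul_apply, smul_eq_mul] at eX eY
    simp only [Pi.zero_apply]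
    -- This is the work identity at third order: each equation of motion is multiplied by the
    -- velocity of the complementary order, and the gyroscopic terms cancel in pairs.
    linear_combination M.D Bx I₁ I₂ φ₁ φ₂ * ex + M.D By I₁ I₂ φ₁ φ₂ * ey
      + M.D M.B₁x I₁ I₂ φ₁ φ₂ * eX + M.D M.B₁y I₁ I₂ φ₁ φ₂ * eY

end IsJet

/-- A form of degree three in `√I₁, √I₂` vanishes if and only if its coefficients do. -/
theorem agree_cubic_iff {f : ActionAngleFun} (hf : f.Agree 0) (A₃₀ A₂₁ A₁₂ A₀₃ : ℝ → ℝ → ℝ) :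
    ActionAngleFun.Agree f
        (fun I₁ I₂ φ₁ φ₂ => A₃₀ φ₁ φ₂ * √I₁ ^ 3 + A₂₁ φ₁ φ₂ * (I₁ * √I₂)
          + A₁₂ φ₁ φ₂ * (√I₁ * I₂) + A₀₃ φ₁ φ₂ * √I₂ ^ 3) ↔
      (A₃₀ = 0 ∧ A₂₁ = 0 ∧ A₁₂ = 0 ∧ A₀₃ = 0) := by
  constructor
  · intro h
    have h' := hf.symm.trans h
    -- The actions `(1, 0)` and `(0, 1)` isolate the pure coefficients; `√I₂ = 1` and `√I₂ = 2` then
    -- separate the two mixed ones.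
    have h4 : √(4 : ℝ) = 2 := by
      rw [show (4 : ℝ) = 2 ^ 2 by norm_num, Real.sqrt_sq (by norm_num)]
    have key (φ₁ φ₂ : ℝ) : A₃₀ φ₁ φ₂ = 0 ∧ A₂₁ φ₁ φ₂ = 0 ∧ A₁₂ φ₁ φ₂ = 0 ∧ A₀₃ φ₁ φ₂ = 0 := by
      have e1 := h' 1 0 φ₁ φ₂ (by norm_num) (by norm_num)
      have e2 := h' 0 1 φ₁ φ₂ (by norm_num) (by norm_num)
      have e3 := h' 1 1 φ₁ φ₂ (by norm_num) (by norm_num)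
      have e4 := h' 1 4 φ₁ φ₂ (by norm_num) (by norm_num)
      simp [h4] at e1 e2 e3 e4
      refine ⟨e1.symm, ?_, ?_, e2.symm⟩ <;> linarith
    exact ⟨funext₂ fun a b => (key a b).1, funext₂ fun a b => (key a b).2.1,
      funext₂ fun a b => (key a b).2.2.1, funext₂ fun a b => (key a b).2.2.2⟩
  · rintro ⟨rfl, rfl, rfl, rfl⟩ I₁ I₂ φ₁ φ₂ h₁ h₂
    rw [hf _ _ _ _ h₁ h₂]
    simp

end PRModel

/-! ### Assembly of the three assertions. -/

theorem mainTheorem2 (M : PRModel)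
    (hμ₀ : 0 < M.μ) (hμ : M.μ ≤ 1 / 2) (hq₀ : 0 < M.q₁) (hq : M.q₁ ≤ 1)
    (hA : 0 ≤ M.A₂) (hcd : 0 < M.cd)
    (heq : M.IsTriangularEquilibrium) (ha : M.xs + M.μ ≠ 0)
    (hfreq : M.HasFrequencies) (hres : M.NonResonant) :
    -- the linear normal form and the first order components
    (M.J ∈ Matrix.symplecticGroup (Fin 2) ℝ ∧
      ∀ I₁ I₂ φ₁ φ₂ : ℝ, 0 ≤ I₁ → 0 ≤ I₂ →
        M.H₂ (Matrix.mulVec M.J (M.T I₁ I₂ φ₁ φ₂)) = M.ω₁ * I₁ - M.ω₂ * I₂) ∧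
    IsDAlembertComp 1 M.B₁x ∧ IsDAlembertComp 1 M.B₁y ∧
    -- none of the divisors of the second order vanishes
    (∀ m ∈ Finset.range 3, ∀ p ∈ dAlembertP (2 - m), ∀ q ∈ dAlembertQ m, M.Δ p q ≠ 0) ∧
    ∃ B₂x B₂y : ActionAngleFun,
      -- the second order components solve the two partial differential equations, uniquely
      (IsDAlembertComp 2 B₂x ∧ IsDAlembertComp 2 B₂y ∧ M.SolvesSecondOrder B₂x B₂y) ∧
      (∀ Bx By : ActionAngleFun, IsDAlembertComp 2 Bx → IsDAlembertComp 2 By →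
        M.SolvesSecondOrder Bx By →
          ActionAngleFun.Agree Bx B₂x ∧ ActionAngleFun.Agree By B₂y) ∧
      -- and they are given by dividing the coefficients of `Φ₂` and `-Ψ₂` by the divisors
      (∃ CΦ SΦ CΨ SΨ : ℕ → ℕ → ℤ → ℝ,
        ActionAngleFun.Agree M.Φ₂ (dAlembertComp 2 CΦ SΦ) ∧
        ActionAngleFun.Agree M.Ψ₂ (dAlembertComp 2 CΨ SΨ) ∧
        ActionAngleFun.Agree B₂x (dAlembertComp 2
          (fun m p q => CΦ m p q / M.Δ p q) (fun m p q => SΦ m p q / M.Δ p q)) ∧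
        ActionAngleFun.Agree B₂y (dAlembertComp 2
          (fun m p q => -CΨ m p q / M.Δ p q) (fun m p q => -SΨ m p q / M.Δ p q))) ∧
      -- the third order part of the Hamiltonian has all its coefficients equal to zero
      (∀ A₃₀ A₂₁ A₁₂ A₀₃ : ℝ → ℝ → ℝ,
        ActionAngleFun.Agree (M.H₃ B₂x B₂y)
          (fun I₁ I₂ φ₁ φ₂ => A₃₀ φ₁ φ₂ * √I₁ ^ 3 + A₂₁ φ₁ φ₂ * (I₁ * √I₂)
            + A₁₂ φ₁ φ₂ * (√I₁ * I₂) + A₀₃ φ₁ φ₂ * √I₂ ^ 3) ↔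
        (A₃₀ = 0 ∧ A₂₁ = 0 ∧ A₁₂ = 0 ∧ A₀₃ = 0)) := by
  obtain ⟨-, -, hy⟩ := heq
  have hEF := PRModel.E_add_F_lt hμ₀ hμ hq₀ hA hy ha
  obtain ⟨s₁, s₂, hn⟩ := PRModel.exists_isNormalization hfreq (PRModel.two_F_lt hfreq hEF)
  obtain ⟨c₃₀, c₂₁, c₁₂, c₀₃, d₀, d₁, d₂, d₃, hj⟩ := PRModel.exists_isJet hy ha
  have hx := hn.isDAlembertComp_B₁x
  have hy := hn.isDAlembertComp_B₁y
  -- The forcing terms are quadratic in the first-order components, hence of degree two by closure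
  -- under products.
  obtain ⟨CX, SX, hX⟩ : IsDAlembertComp 2 M.X₂ :=
    ((((hx.mul hx).smul _).add ((hx.mul hy).smul _)).add ((hy.mul hy).smul _)).congr
      (hj.X₂_agree hn)
  obtain ⟨CY, SY, hY⟩ : IsDAlembertComp 2 M.Y₂ :=
    ((((hx.mul hx).smul _).add ((hx.mul hy).smul _)).add ((hy.mul hy).smul _)).congr
      (hj.Y₂_agree hn)
  obtain ⟨CΦ, SΦ, CΨ, SΨ, hΦ, hΨ, hB⟩ := PRModel.exists_solvesSecondOrder hfreq hres hX hY
  have hBx := IsDAlembertComp.dAlembertComp 2 (fun m p q => CΦ m p q / M.Δ p q)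
    (fun m p q => SΦ m p q / M.Δ p q)
  have hBy := IsDAlembertComp.dAlembertComp 2 (fun m p q => -CΨ m p q / M.Δ p q)
    (fun m p q => -SΨ m p q / M.Δ p q)
  refine ⟨⟨hn.J_mem_symplecticGroup, fun I₁ I₂ φ₁ φ₂ h₁ h₂ => hn.H₂_eq h₁ h₂ φ₁ φ₂⟩, hx, hy,
    fun m hm p hp q hq => PRModel.Δ_ne_zero_of_degree_two hres hm hp hq, _, _,
    ⟨hBx, hBy, hB⟩, ?_, ⟨CΦ, SΦ, CΨ, SΨ, hΦ, hΨ, fun _ _ _ _ _ _ => rfl,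
      fun _ _ _ _ _ _ => rfl⟩, PRModel.agree_cubic_iff (hj.H₃_agree_zero hn hres hBx hBy hB)⟩
  rintro Bx By ⟨Cx, Sx, hCx⟩ ⟨Cy, Sy, hCy⟩ hsol
  have hu := PRModel.secondOrder_unique hfreq hres hX hY (hsol.congr hCx hCy) hB
  exact ⟨hu.1 ▸ hCx, hu.2 ▸ hCy⟩
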